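/- Let $d\ge 1$ and let $\mathscr T_1,\dots,\mathscr T_d$ be locally finite, leafless, rooted directed trees, $\mathscr T_j$ having vertex set $V_j$ and root $\mathsf{root}_j$. Let $\mathscr T$ be their directed Cartesian product, with vertex set $V=V_1\times\cdots\times V_d$. For $v\in V$ let $\mathsf d_v=(\mathsf d_{v_1},\dots,\mathsf d_{v_d})\in\mathbb N^d$ be its depth ($\mathsf d_{v_j}$ is the depth of $v_j$ in $\mathscr T_j$), and let $\mathsf{Chi}_j(v)$ be the set of vertices obtained from $v$ by replacing $v_j$ by one of its children; similarly $\mathsf{sib}_j(v)$, with a sibling of $v_j$ (a child of the parent of $v_j$, $v_j$ included), and $\mathsf{par}_j(v)$, with the parent of $v_j\neq\mathsf{root}_j$. Assume that $\mathscr T$ is of finite joint branching index, i.e. in each $\mathscr T_j$ the depths of the vertices with at least two children are bounded. Let $\mathfrak c:\mathbb N\to(0,\infty)$ satisfy $\inf\mathfrak c>0$ and $\sup\mathfrak c<\infty$, and put $$\lambda_j(w)=\sqrt{\frac{\mathfrak c(|\mathsf d_v|)}{\mathrm{card}(\mathsf{Chi}_j(v))}}\sqrt{\frac{\mathsf d_{v_j}+1}{|\mathsf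 d_v|+d}},\qquad w\in\mathsf{Chi}_j(v),\ v\in V,\ j=1,\dots,d.$$ Let $S_{\lambda_{\mathfrak c}}=(S_1,\dots,S_d)$ be the $d$-tuple of bounded operators on $l^2(V)$ with $(S_jf)(v)=\lambda_j(v)f(\mathsf{par}_j(v))$ if $v_j\ne\mathsf{root}_j$ and $(S_jf)(v)=0$ otherwise, and let $E=\bigcap_{j}\ker S_j^*$. For $F\subseteq\{1,\dots,d\}$ let $\Phi_F$ be the set of those $v\in V$ with $v_j\neq\mathsf{root}_j$ exactly for $j\in F$. For $u\in\Phi_F$ let $\mathsf{sib}_F(u)$ be the set of $v\in V$ such that $v_j$ is a sibling of $u_j$ for $j\in F$ and $v_j=u_j$ for $j\notin F$. Let $\Omega_F\subseteq\Phi_F$ contain exactly one element of each of the classes $\mathsf{sib}_F(u)$, $u\in\Phi_F$. For $u\in\Omega_F$ let $\mathcal L_{u,F}$ be the space of all $f\in l^2(V)$ vanishing off $\mathsf{sib}_F(u)$ with $$\sum_{w\in\mathsf{sib}_j(v')}\lambda_j(w)f(w)=0\qquad\text{for all }j\in F\text{ and }v\in\mathsf{sib}_F(u),$$ where $v'$ is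 $v$ with its $j$-th coordinate replaced by $u_j$. Then $\mathcal L_{u,F}\subseteq E$ for all $F$ and all $u\in\Omega_F$, and there are $r>0$ and a reproducing kernel Hilbert space $\mathscr H_{\mathfrak c}(\mathscr T)$ of $E$-valued holomorphic functions on the open ball $\mathbb B^d_r$ of radius $r$ centred at $0$ in $\mathbb C^d$, on which the multiplications $\mathscr M_{z_1},\dots,\mathscr M_{z_d}$ by the coordinate functions are bounded operators, such that $S_{\lambda_{\mathfrak c}}$ is unitarily equivalent to $(\mathscr M_{z_1},\dots,\mathscr M_{z_d})$: there is one unitary $U:l^2(V)\to\mathscr H_{\mathfrak c}(\mathscr T)$ with $US_j=\mathscr M_{z_j}U$ for all $j$. The $B(E)$-valued reproducing kernel of $\mathscr H_{\mathfrak c}(\mathscr T)$ is $$\kappa(z,w)=\sum_{F\subseteq\{1,\dots,d\}}\ \sum_{u\in\Omega_F}\Big(\sum_{\alpha\in\mathbb N^d}\frac{\mathsf d_u!}{(\mathsf d_u+\alpha)!}\prod_{j=0}^{|\alpha|-1}\frac{|\mathsf d_u|+d+j}{\mathfrak c(|\mathsf d_u|+j)}\,z^\alpha\overline w^\alpha\Big)P_{\mathcal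 L_{u,F}},\qquad z,w\in\mathbb B^d_r,$$ where $P_{\mathcal L_{u,F}}$ is the orthogonal projection of $E$ onto $\mathcal L_{u,F}$; all the series converge (unconditionally) for $z,w\in\mathbb B^d_r$. -/

import Mathlib

open scoped ENNReal NNReal lp

universe u

/-- A rooted directed tree on the vertex set `V`: a directed graph without loops and circuits,
connected (as an undirected graph), having a root (a vertex without parent), and such that every
other vertex has exactly one parent. -/
structure RootedDirectedTree (V : Type u) extends Digraph V where
  root : V
  no_circuit : ∀ v, ¬ Relation.TransGen Adj v v
  connected : ∀ v w, Relation.EqvGen Adj v w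
  root_no_parent : ∀ v, ¬ Adj v root
  existsUnique_parent : ∀ v, v ≠ root → ∃! p, Adj p v

namespace RootedDirectedTree

variable {V : Type u} (T : RootedDirectedTree V)

/-- The children of a vertex. -/
def chi (v : V) : Set V := {w | T.Adj v w}

/-- The children of a set of vertices. -/
def chiSet (W : Set V) : Set V := {w | ∃ v ∈ W, T.Adj v w}

/-- The siblings of a vertex `v` (including `v`): the children of its parent. The root has none. -/
def sib (v : V) : Set V := {w | ∃ p, T.Adj p v ∧ T.Adj p w}

open Classical in
/-- The parent of a vertex (by convention, the root itself for the root). -/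
noncomputable def par (v : V) : V :=
  if h : v = T.root then T.root else (T.existsUnique_parent v h).choose

/-- Every vertex lies in exactly one of the sets `Chi^n(root)`. -/
theorem existsUnique_depth (v : V) : ∃! n : ℕ, v ∈ T.chiSet^[n] {T.root} := by
  have key : ∀ a b, T.Adj a b →
      ((∃ n, a ∈ T.chiSet^[n] {T.root}) ↔ ∃ n, b ∈ T.chiSet^[n] {T.root}) := by
    intro a b hab
    constructor
    · rintro ⟨n, hn⟩
      exact ⟨n + 1, by rw [Function.iterate_succ_apply']; exact ⟨a, hn, hab⟩⟩
    · rintro ⟨n, hn⟩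
      cases n with
      | zero =>
        have hb : b = T.root := hn
        exact absurd (hb ▸ hab) (T.root_no_parent a)
      | succ n =>
        rw [Function.iterate_succ_apply'] at hn
        obtain ⟨a', ha', hab'⟩ := hn
        have hb : b ≠ T.root := fun h => T.root_no_parent a (h ▸ hab)
        exact ⟨n, (T.existsUnique_parent b hb).unique hab' hab ▸ ha'⟩
  have key2 : ∀ a b, Relation.EqvGen T.Adj a b →
      ((∃ n, a ∈ T.chiSet^[n] {T.root}) ↔ ∃ n, b ∈ T.chiSet^[n] {T.root}) := by
    intro a b h
    induction h with
    | rel x y h => exact key x y h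
    | refl x => rfl
    | symm x y _ ih => exact ih.symm
    | trans x y z _ _ ih1 ih2 => exact ih1.trans ih2
  have ex := (key2 _ _ (T.connected T.root v)).1 ⟨0, rfl⟩
  have uniq : ∀ n m : ℕ, ∀ v, v ∈ T.chiSet^[n] {T.root} → v ∈ T.chiSet^[m] {T.root} → n = m := by
    intro n
    induction n with
    | zero =>
      intro m v hv hm
      cases m with
      | zero => rfl
      | succ m =>
        rw [Function.iterate_succ_apply'] at hm
        obtain ⟨a, _, ha⟩ := hm
        have hv' : v = T.root := hv
        exact absurd (hv' ▸ ha) (T.root_no_parent a)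
    | succ n ih =>
      intro m v hv hm
      rw [Function.iterate_succ_apply'] at hv
      obtain ⟨a, ha, hav⟩ := hv
      cases m with
      | zero =>
        have hv' : v = T.root := hm
        exact absurd (hv' ▸ hav) (T.root_no_parent a)
      | succ m =>
        rw [Function.iterate_succ_apply'] at hm
        obtain ⟨b, hb, hbv⟩ := hm
        have hr : v ≠ T.root := fun h => T.root_no_parent a (h ▸ hav)
        have hab := (T.existsUnique_parent v hr).unique hav hbv
        rw [ih m a ha (hab ▸ hb)]
  obtain ⟨n, hn⟩ := ex
  exact ⟨n, hn, fun m hm => uniq m n v hm hn⟩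

/-- The depth of `v`: the unique `n` with `v ∈ Chi^n(root)`. -/
noncomputable def depth (v : V) : ℕ := (T.existsUnique_depth v).choose

/-- The tree is leafless: every vertex has a child. -/
def IsLeafless : Prop := ∀ v, (T.chi v).Nonempty

/-- The tree is locally finite: every vertex has finitely many children. -/
class IsLocallyFinite : Prop where
  finite_chi : ∀ v, (T.chi v).Finite

/-- The branching vertices: those with at least two children. -/
def branching : Set V := {v | 2 ≤ (T.chi v).encard}

open Classical in
/-- The branching index of the tree: `1 + sup` of the depths of the branching vertices if there are
any, and `0` otherwise. -/
noncomputable def branchingIndex : ℕ∞ :=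
  if T.branching.Nonempty then 1 + ⨆ w ∈ T.branching, (T.depth w : ℕ∞) else 0

theorem par_eq {v w : V} (h : T.Adj v w) : T.par w = v := by
  have hw : w ≠ T.root := fun e => T.root_no_parent v (e ▸ h)
  unfold par
  rw [dif_neg hw]
  exact (T.existsUnique_parent w hw).unique (T.existsUnique_parent w hw).choose_spec.1 h

theorem adj_par {w : V} (hw : w ≠ T.root) : T.Adj (T.par w) w := by
  unfold par
  rw [dif_neg hw]
  exact (T.existsUnique_parent w hw).choose_spec.1

theorem finite_sib [T.IsLocallyFinite] (v : V) : (T.sib v).Finite := by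
  refine (IsLocallyFinite.finite_chi (T := T) (T.par v)).subset ?_
  rintro w ⟨p, hp, hw⟩
  rw [T.par_eq hp]
  exact hw

end RootedDirectedTree

/-! ### The directed Cartesian product of a finite family of rooted directed trees

The vertices are the tuples `v = (v_1, …, v_d)`. -/

namespace TreeProduct

variable {d : ℕ} {V : Fin d → Type u} (T : ∀ j, RootedDirectedTree (V j))

/-- The directed Cartesian product has finite joint branching index: all components of its
branching index are finite. -/
def FiniteJointBranchingIndex : Prop := ∀ j, (T j).branchingIndex < ⊤

/-- The depth of a vertex of the product, a multiindex. -/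
noncomputable def depth (v : ∀ j, V j) : Fin d → ℕ := fun j => (T j).depth (v j)

/-- `Chi_j(v)`: replace the `j`-th coordinate by one of its children. -/
def chi (j : Fin d) (v : ∀ j, V j) : Set (∀ j, V j) :=
  {w | w j ∈ (T j).chi (v j) ∧ ∀ i, i ≠ j → w i = v i}

/-- `par_j(v)`: replace the `j`-th coordinate by its parent. -/
noncomputable def par (j : Fin d) (v : ∀ j, V j) : ∀ j, V j :=
  Function.update v j ((T j).par (v j))

/-- `sib_j(v)`: replace the `j`-th coordinate by one of its siblings. -/
def sib (j : Fin d) (v : ∀ j, V j) : Set (∀ j, V j) :=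
  {w | w j ∈ (T j).sib (v j) ∧ ∀ i, i ≠ j → w i = v i}

/-- `Φ_F`: the vertices whose coordinates different from the root are those with index in `F`. -/
def Phi (F : Finset (Fin d)) : Set (∀ j, V j) := {v | ∀ j, j ∈ F ↔ v j ≠ (T j).root}

/-- `sib_F(u) = sib_{i_1} ⋯ sib_{i_k}(u)` for `F = {i_1, …, i_k}`. -/
def sibF (F : Finset (Fin d)) (v : ∀ j, V j) : Set (∀ j, V j) :=
  {w | (∀ j ∈ F, w j ∈ (T j).sib (v j)) ∧ ∀ j, j ∉ F → w j = v j}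

/-- `Ω` is an indexing set for `F`: it contains exactly one element of each of the equivalence
classes `sib_F(v)`, `v ∈ Φ_F`. -/
def IsIndexingSet (F : Finset (Fin d)) (Ω : Set (∀ j, V j)) : Prop :=
  Ω ⊆ Phi T F ∧ ∀ v ∈ Phi T F, ∃! u, u ∈ Ω ∧ u ∈ sibF T F v

open Classical in
/-- `v_G`: the coordinates with index outside `G` are replaced by the roots. -/
noncomputable def restrict (G : Finset (Fin d)) (v : ∀ j, V j) : ∀ j, V j :=
  fun j => if j ∈ G then v j else (T j).root

/-- The Hilbert space `l²(V)`. -/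
abbrev L2 (V : Fin d → Type u) : Type u := ℓ²(∀ j, V j, ℂ)

/-- The map `Λ^{(j)}` on complex functions on the vertices. The weights `lam j v` with
`v j = root` are never used. -/
noncomputable def shiftFun (lam : Fin d → (∀ j, V j) → ℝ) (j : Fin d) (f : (∀ j, V j) → ℂ) :
    (∀ j, V j) → ℂ := by
  classical
  exact fun v => if v j = (T j).root then 0 else (lam j v : ℂ) * f (par T j v)

/-- The condition `sup_v ∑_{w ∈ Chi_j(v)} λ_j(w)² < ∞` for all `j`. -/
def IsBoundedWeights (lam : Fin d → (∀ j, V j) → ℝ) : Prop :=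
  ∃ M : ℝ≥0, ∀ j v, ∑' w : chi T j v, ENNReal.ofReal (lam j w ^ 2) ≤ M

section bounded

variable {T} {lam : Fin d → (∀ j, V j) → ℝ}

theorem tsum_shiftFun_le {M : ℝ≥0}
    (hM : ∀ j v, ∑' w : chi T j v, ENNReal.ofReal (lam j w ^ 2) ≤ M) (j : Fin d)
    (f : (∀ j, V j) → ℂ) :
    ∑' v, ‖shiftFun T lam j f v‖ₑ ^ 2 ≤ M * ∑' v, ‖f v‖ₑ ^ 2 := by
  classical
  rw [← ENNReal.tsum_fiberwise _ (par T j), ← ENNReal.tsum_mul_left]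
  refine ENNReal.tsum_le_tsum fun v => ?_
  calc ∑' b : (par T j) ⁻¹' {v}, ‖shiftFun T lam j f b‖ₑ ^ 2
      = ∑' b, ((par T j) ⁻¹' {v}).indicator (fun b => ‖shiftFun T lam j f b‖ₑ ^ 2) b :=
        tsum_subtype ((par T j) ⁻¹' {v}) (fun b => ‖shiftFun T lam j f b‖ₑ ^ 2)
    _ ≤ ∑' b, (chi T j v).indicator
          (fun b => ENNReal.ofReal (lam j b ^ 2) * ‖f v‖ₑ ^ 2) b := by
        refine ENNReal.tsum_le_tsum fun b => ?_
        by_cases hb : b ∈ (par T j) ⁻¹' {v}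
        · rw [Set.indicator_of_mem hb]
          have hb' : par T j b = v := hb
          by_cases hr : b j = (T j).root
          · simp [shiftFun, hr]
          · have hc : b ∈ chi T j v := by
              subst hb'
              refine ⟨?_, fun i hi => ?_⟩
              · simpa [par, RootedDirectedTree.chi] using (T j).adj_par hr
              · simp [par, hi]
            rw [Set.indicator_of_mem hc]
            simp only [shiftFun, hr, if_false, hb', enorm_mul, mul_pow]
            gcongr
            rw [← ofReal_norm, ← ENNReal.ofReal_pow (norm_nonneg _)]
            simp
        · rw [Set.indicator_of_notMem hb]
          exact zero_le
    _ = ∑' b : chi T j v, ENNReal.ofReal (lam j b ^ 2) * ‖f v‖ₑ ^ 2 := 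
        (tsum_subtype (chi T j v) (fun b => ENNReal.ofReal (lam j b ^ 2) * ‖f v‖ₑ ^ 2)).symm
    _ = (∑' b : chi T j v, ENNReal.ofReal (lam j b ^ 2)) * ‖f v‖ₑ ^ 2 := ENNReal.tsum_mul_right
    _ ≤ M * ‖f v‖ₑ ^ 2 := by gcongr; exact hM j v

theorem memlp_two_iff {ι : Type*} {f : ι → ℂ} : Memℓp f 2 ↔ ∑' v, ‖f v‖ₑ ^ 2 ≠ ⊤ := by
  have h : ∀ v, ‖f v‖ₑ ^ 2 = ((‖f v‖₊ ^ 2 : ℝ≥0) : ℝ≥0∞) := fun v => by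
    rw [ENNReal.coe_pow]; rfl
  simp_rw [h]
  rw [ENNReal.tsum_coe_ne_top_iff_summable_coe, memℓp_gen_iff (by norm_num)]
  simp

theorem ofReal_norm_sq {ι : Type*} (f : ℓ²(ι, ℂ)) :
    ENNReal.ofReal (‖f‖ ^ 2) = ∑' v, ‖f v‖ₑ ^ 2 := by
  have h1 : ‖f‖ ^ 2 = ∑' v, ‖f v‖ ^ 2 := by
    have := lp.norm_rpow_eq_tsum (p := 2) (by norm_num) f
    simpa using this
  have h2 : Summable fun v => ‖f v‖ ^ 2 := by
    have := (lp.memℓp f).summable (by norm_num)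
    simpa using this
  rw [h1, ENNReal.ofReal_tsum_of_nonneg (fun v => by positivity) h2]
  refine tsum_congr fun v => ?_
  rw [ENNReal.ofReal_pow (norm_nonneg _), ofReal_norm]

theorem memlp_shiftFun (h : IsBoundedWeights T lam) (j : Fin d) (f : L2 V) :
    Memℓp (shiftFun T lam j f) 2 := by
  obtain ⟨M, hM⟩ := h
  rw [memlp_two_iff]
  exact ne_top_of_le_ne_top
    (ENNReal.mul_ne_top ENNReal.coe_ne_top (memlp_two_iff.1 (lp.memℓp f)))
    (tsum_shiftFun_le hM j f)

variable (T lam) in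
/-- The `j`-th component `S_j` of the multishift with bounded weights, as a linear map. -/
noncomputable def multishiftLM (h : IsBoundedWeights T lam) (j : Fin d) : L2 V →ₗ[ℂ] L2 V where
  toFun f := ⟨shiftFun T lam j f, memlp_shiftFun h j f⟩
  map_add' f g := by
    ext v
    change shiftFun T lam j (⇑(f + g)) v = shiftFun T lam j f v + shiftFun T lam j g v
    by_cases hr : v j = (T j).root <;> simp [shiftFun, hr, mul_add]
  map_smul' a f := by
    ext v
    change shiftFun T lam j (⇑(a • f)) v = a * shiftFun T lam j f v
    by_cases hr : v j = (T j).root <;> simp [shiftFun, hr, mul_left_comm]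

theorem exists_bound_multishiftLM (h : IsBoundedWeights T lam) (j : Fin d) :
    ∃ C : ℝ, ∀ f, ‖multishiftLM T lam h j f‖ ≤ C * ‖f‖ := by
  obtain ⟨M, hM⟩ := id h
  refine ⟨Real.sqrt M, fun f => ?_⟩
  refine abs_le_of_sq_le_sq' ?_ (by positivity) |>.2
  have h1 : ENNReal.ofReal (‖multishiftLM T lam h j f‖ ^ 2) ≤ ENNReal.ofReal (M * ‖f‖ ^ 2) := by
    rw [ENNReal.ofReal_mul (by positivity), ofReal_norm_sq, ofReal_norm_sq,
      ENNReal.ofReal_coe_nnreal]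
    exact tsum_shiftFun_le hM j f
  rw [mul_pow, Real.sq_sqrt (by positivity)]
  exact (ENNReal.ofReal_le_ofReal_iff (by positivity)).1 h1

end bounded

/-- The `j`-th component `S_j` of the multishift `S_λ` with bounded weights, as a bounded operator
on `l²(V)`: `S_j f = Λ^{(j)} f`. -/
noncomputable def multishift (lam : Fin d → (∀ j, V j) → ℝ) (h : IsBoundedWeights T lam)
    (j : Fin d) : L2 V →L[ℂ] L2 V :=
  (multishiftLM T lam h j).mkContinuousOfExistsBound (exists_bound_multishiftLM h j)

/-- The joint kernel `E = ⋂_j ker S_j^*`. -/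
noncomputable def jointKernel (lam : Fin d → (∀ j, V j) → ℝ) (h : IsBoundedWeights T lam) :
    Submodule ℂ (L2 V) :=
  ⨅ j, (ContinuousLinearMap.adjoint (multishift T lam h j)).ker

instance completeSpace_jointKernel (lam : Fin d → (∀ j, V j) → ℝ) (h : IsBoundedWeights T lam) :
    CompleteSpace (jointKernel T lam h) := by
  have : IsClosed (jointKernel T lam h : Set (L2 V)) := by
    unfold jointKernel
    rw [Submodule.coe_iInf]
    exact isClosed_iInter fun j => ContinuousLinearMap.isClosed_ker _
  exact this.completeSpace_coe

/-- `𝓛_{u,F}`: the functions in `l²(sib_F(u))` which solve the system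
`∑_{w ∈ sib_j(v_G | u_j)} λ_j(w) f(w) = 0`, `j ∈ F`, `G = F \ {j}`, `v ∈ sib_F(u)`.
(If the trees are locally finite, the sums are finite.) -/
noncomputable def solSpace (lam : Fin d → (∀ j, V j) → ℝ) (F : Finset (Fin d)) (u : ∀ j, V j) :
    Submodule ℂ (L2 V) where
  carrier := {f | (∀ v, v ∉ sibF T F u → f v = 0) ∧
    ∀ j ∈ F, ∀ v ∈ sibF T F u,
      HasSum (fun w : sib T j (Function.update (restrict T (F.erase j) v) j (u j)) =>
        (lam j w : ℂ) * f w) 0}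
  zero_mem' := by
    refine ⟨fun v _ => rfl, fun j _ v _ => ?_⟩
    simp [hasSum_zero]
  add_mem' := by
    rintro f g ⟨hf, hf'⟩ ⟨hg, hg'⟩
    refine ⟨fun v hv => by simp [hf v hv, hg v hv], fun j hj v hv => ?_⟩
    simpa [mul_add] using (hf' j hj v hv).add (hg' j hj v hv)
  smul_mem' := by
    rintro a f ⟨hf, hf'⟩
    refine ⟨fun v hv => by simp [hf v hv], fun j hj v hv => ?_⟩
    simpa [mul_left_comm] using (hf' j hj v hv).mul_left a

theorem finite_sibF [∀ j, (T j).IsLocallyFinite] (F : Finset (Fin d)) (u : ∀ j, V j) :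
    (sibF T F u).Finite := by
  classical
  refine (Set.Finite.pi (t := fun j => if j ∈ F then (T j).sib (u j) else {u j})
    fun j => ?_).subset ?_
  · by_cases hj : j ∈ F
    · simpa [hj] using (T j).finite_sib (u j)
    · simp [hj]
  · rintro v ⟨h1, h2⟩ j -
    by_cases hj : j ∈ F
    · simpa [hj] using h1 j hj
    · simpa [hj] using h2 j hj

instance finiteDimensional_solSpace [∀ j, (T j).IsLocallyFinite]
    (lam : Fin d → (∀ j, V j) → ℝ) (F : Finset (Fin d)) (u : ∀ j, V j) :
    FiniteDimensional ℂ (solSpace T lam F u) := by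
  have : Finite (sibF T F u) := finite_sibF T F u
  let φ : solSpace T lam F u →ₗ[ℂ] (sibF T F u → ℂ) :=
    { toFun := fun f v => (f : L2 V) v
      map_add' := fun f g => rfl
      map_smul' := fun a f => rfl }
  refine FiniteDimensional.of_injective φ fun f g hfg => ?_
  ext v
  by_cases hv : v ∈ sibF T F u
  · exact congrFun hfg ⟨v, hv⟩
  · rw [f.2.1 v hv, g.2.1 v hv]

/-- `𝓛_{u,F}` as a subspace of the joint kernel `E`. -/
noncomputable def solSpaceIn (lam : Fin d → (∀ j, V j) → ℝ) (h : IsBoundedWeights T lam)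
    (F : Finset (Fin d)) (u : ∀ j, V j) : Submodule ℂ (jointKernel T lam h) :=
  (solSpace T lam F u).comap (jointKernel T lam h).subtype

instance finiteDimensional_solSpaceIn [∀ j, (T j).IsLocallyFinite]
    (lam : Fin d → (∀ j, V j) → ℝ) (h : IsBoundedWeights T lam) (F : Finset (Fin d))
    (u : ∀ j, V j) : FiniteDimensional ℂ (solSpaceIn T lam h F u) := by
  let φ : solSpaceIn T lam h F u →ₗ[ℂ] solSpace T lam F u :=
    { toFun := fun f => ⟨f.1.1, f.2⟩
      map_add' := fun f g => rfl
      map_smul' := fun a f => rfl }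
  refine FiniteDimensional.of_injective φ fun f g hfg => ?_
  exact Subtype.ext (Subtype.ext (congrArg (solSpace T lam F u).subtype hfg))

/-- The orthogonal projection `P_{𝓛_{u,F}} ∈ B(E)`. -/
noncomputable def projL [∀ j, (T j).IsLocallyFinite]
    (lam : Fin d → (∀ j, V j) → ℝ) (h : IsBoundedWeights T lam) (F : Finset (Fin d))
    (u : ∀ j, V j) : jointKernel T lam h →L[ℂ] jointKernel T lam h :=
  (solSpaceIn T lam h F u).starProjection

/-- The weight system `λ_c`: for `w ∈ Chi_j(v)`, so that `v = par_j(w)`,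
`λ_j(w) = √(c(|d_v|) / card Chi_j(v)) √((d_{v_j} + 1) / (|d_v| + d))`. -/
noncomputable def weights (c : ℕ → ℝ) (j : Fin d) (w : ∀ j, V j) : ℝ :=
  √(c (∑ i, depth T (par T j w) i) / (chi T j (par T j w)).ncard) *
    √((depth T (par T j w) j + 1) / ((∑ i, depth T (par T j w) i : ℕ) + d))

/-- If `c` is bounded above then the weights `λ_c` define bounded operators. -/
theorem isBoundedWeights_weights (c : ℕ → ℝ) (hc : BddAbove (Set.range c)) :
    IsBoundedWeights T (weights T c) := by
  obtain ⟨B, hB⟩ := hc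
  refine ⟨B.toNNReal, fun j v => ?_⟩
  have hpar : ∀ w ∈ chi T j v, par T j w = v := by
    rintro w ⟨h1, h2⟩
    funext i
    by_cases hi : i = j
    · subst hi
      simpa [par] using (T i).par_eq h1
    · simp [par, hi, h2 i hi]
  set n := ∑ i, depth T v i with hn
  have hle : ∀ w : chi T j v, ENNReal.ofReal (weights T c j w ^ 2) ≤
      ENNReal.ofReal (B.toNNReal / (chi T j v).ncard) := by
    intro w
    apply ENNReal.ofReal_le_ofReal
    unfold weights
    rw [hpar w w.2, mul_pow, Real.sq_sqrt (x := (_ + 1) / _) (by positivity)]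
    have hfrac : ((depth T v j : ℝ) + 1) / ((n : ℕ) + d) ≤ 1 := by
      have h1 : depth T v j ≤ n := Finset.single_le_sum (f := depth T v) (fun _ _ => Nat.zero_le _)
        (Finset.mem_univ j)
      have h2 : 1 ≤ d := Nat.succ_le_of_lt (Fin.pos j)
      apply div_le_one_of_le₀
      · have h3 : depth T v j + 1 ≤ n + d := by omega
        exact_mod_cast h3
      · positivity
    have hcB : √(c n / (chi T j v).ncard) ^ 2 ≤ B.toNNReal / (chi T j v).ncard := by
      have hmono : c n / (chi T j v).ncard ≤ B.toNNReal / (chi T j v).ncard := by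
        gcongr
        exact (hB ⟨n, rfl⟩).trans (Real.le_coe_toNNReal B)
      calc √(c n / (chi T j v).ncard) ^ 2 ≤ √(B.toNNReal / (chi T j v).ncard) ^ 2 := by
            gcongr
        _ = _ := Real.sq_sqrt (by positivity)
    calc _ ≤ √(c n / (chi T j v).ncard) ^ 2 * 1 := by gcongr
      _ ≤ _ := by rw [mul_one]; exact hcB
  refine (ENNReal.tsum_le_tsum hle).trans ?_
  by_cases hfin : (chi T j v).Finite
  · have := hfin.fintype
    rw [tsum_fintype, Finset.sum_const, Finset.card_univ, ← Nat.card_eq_fintype_card,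
      Nat.card_coe_set_eq, nsmul_eq_mul]
    by_cases h0 : (chi T j v).ncard = 0
    · simp [h0]
    · have : (0 : ℝ) < (chi T j v).ncard := by positivity
      rw [← ENNReal.ofReal_natCast, ← ENNReal.ofReal_mul (by positivity), mul_div_cancel₀ _ this.ne']
      simp
  · rw [Set.not_finite.1 hfin |>.ncard]
    simp

section family

variable (c : ℕ → ℝ) (hc : BddAbove (Set.range c))

/-- The components `S_1, …, S_d` of the multishift `S_{λ_c}`. -/
noncomputable abbrev multishiftOf (j : Fin d) : L2 V →L[ℂ] L2 V :=
  multishift T (weights T c) (isBoundedWeights_weights T c hc) j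

/-- The joint kernel `E` of `S_{λ_c}^*`. -/
noncomputable abbrev jointKernelOf : Submodule ℂ (L2 V) :=
  jointKernel T (weights T c) (isBoundedWeights_weights T c hc)

/-- The orthogonal projection of `E` onto `𝓛_{u,F}`. -/
noncomputable abbrev projOf [∀ j, (T j).IsLocallyFinite] (F : Finset (Fin d)) (u : ∀ j, V j) :
    jointKernelOf T c hc →L[ℂ] jointKernelOf T c hc :=
  projL T (weights T c) (isBoundedWeights_weights T c hc) F u

end family

/-- The scalar coefficient
`d_u! / (d_u + α)! ∏_{j < |α|} (|d_u| + d + j) / c(|d_u| + j)`, where `δ = d_u`. -/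
noncomputable def kernelCoeff (c : ℕ → ℝ) (δ α : Fin d → ℕ) : ℝ :=
  ((∏ i, (δ i).factorial : ℕ) : ℝ) / ((∏ i, (δ i + α i).factorial : ℕ) : ℝ) *
    ∏ j ∈ Finset.range (∑ i, α i), ((∑ i, δ i : ℕ) + d + j : ℝ) / c ((∑ i, δ i) + j)

/-- The term of index `α` of the scalar series, with `z^α \bar w^α`. -/
noncomputable def kernelTerm (c : ℕ → ℝ) (δ : Fin d → ℕ) (z w : EuclideanSpace ℂ (Fin d))
    (α : Fin d → ℕ) : ℂ :=
  (kernelCoeff c δ α : ℂ) * (∏ i, z i ^ α i) * ∏ i, (starRingEnd ℂ (w i)) ^ α i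

/-- The open ball `𝔹^d_r` of `ℂ^d`. -/
abbrev Ball (d : ℕ) (r : ℝ) : Set (EuclideanSpace ℂ (Fin d)) := Metric.ball 0 r

end TreeProduct

/-!
The weight `λ_j` is constant on each `Chi_j(v)`, so `S_j^* S_j` multiplies the functions supported
on vertices of a fixed depth `δ` by a scalar depending on `δ`, and `S_k` preserves `ker S_j^*` for
`k ≠ j`. Hence for `x ∈ E` and `y ∈ 𝓛_{u,F}` the vectors `S^α x` and `S^β y` are orthogonal for
`α ≠ β`, and `⟨S^α x, S^α y⟩ = a_u(α)⁻¹ ⟨x, y⟩`, where `a_u(α)` is the coefficient of `z^α w̄^α` in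
the kernel. The spaces `S^α 𝓛_{u,F}` span `l²(V)`, and finite joint branching index makes all but
finitely many `𝓛_{u,F}` zero. So `f ↦ ∑_α z^α ∑_{u,F} a_u(α) P_{𝓛_{u,F}} (S^α)^* f` represents
`l²(V)` by power series on a small ball. It turns `S_j` into multiplication by `z_j`, and the
reproducing kernel is read off from its values on `𝓛_{u,F}`.
-/

namespace MultiPowerSeries

theorem summable_pow_sum (d : ℕ) {ρ : ℝ} (h0 : 0 ≤ ρ) (h1 : ρ < 1) :
    Summable fun α : Fin d → ℕ => ρ ^ ∑ i, α i := by
  induction d with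
  | zero => exact (hasSum_fintype _).summable
  | succ d ih =>
    rw [← (Fin.consEquiv fun _ => ℕ).summable_iff]
    refine ((summable_geometric_of_lt_one h0 h1).mul_of_nonneg ih (fun _ => by positivity)
      (fun _ => by positivity)).congr fun x => ?_
    simp [Fin.consEquiv, Fin.sum_univ_succ, pow_add]

theorem norm_prod_pow_le {ι 𝕜 : Type*} [Fintype ι] [NormedField 𝕜] {z : ι → 𝕜} {r : ℝ}
    (hz : ∀ i, ‖z i‖ ≤ r) (α : ι → ℕ) : ‖∏ i, z i ^ α i‖ ≤ r ^ ∑ i, α i := by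
  rw [norm_prod, ← Finset.prod_pow_eq_pow_sum]
  refine Finset.prod_le_prod (fun _ _ => norm_nonneg _) fun i _ => ?_
  rw [norm_pow]
  exact pow_le_pow_left₀ (norm_nonneg _) (hz i) _

section uniqueness

variable {F : Type*} [NormedAddCommGroup F] [NormedSpace ℂ F] {r : ℝ}

theorem eq_zero_of_hasSum_pow {b : ℕ → F} (hr : 0 < r)
    (h : ∀ t : ℂ, ‖t‖ < r → HasSum (fun n => t ^ n • b n) 0) : b = 0 := by
  let p : FormalMultilinearSeries ℂ ℂ F := fun n =>
    ContinuousMultilinearMap.mkPiRing ℂ (Fin n) (b n)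
  have hcoeff : ∀ n, p.coeff n = b n := fun n => by simp [p, FormalMultilinearSeries.coeff]
  have hp : HasFPowerSeriesAt (fun _ : ℂ => (0 : F)) p 0 := by
    rw [hasFPowerSeriesAt_iff]
    filter_upwards [Metric.ball_mem_nhds (0 : ℂ) hr] with t ht
    simpa [hcoeff] using h t (by simpa using ht)
  funext n
  rw [← hcoeff, hp.eq_zero]
  rfl

theorem hasSum_cons {d : ℕ} {b : (Fin (d + 1) → ℕ) → F} {s : F} {t : ℂ} {z : Fin d → ℂ}
    (h : HasSum (fun α => (∏ i, (Fin.cons t z : Fin (d + 1) → ℂ) i ^ α i) • b α) s) :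
    HasSum (fun x : ℕ × (Fin d → ℕ) => t ^ x.1 • (∏ i, z i ^ x.2 i) • b (Fin.cons x.1 x.2)) s := by
  refine ((Fin.consEquiv fun _ => ℕ).hasSum_iff.2 h).congr_fun fun x => ?_
  simp [Fin.consEquiv, Fin.prod_univ_succ, mul_smul]

theorem eq_zero_of_hasSum [CompleteSpace F] (hr : 0 < r) :
    ∀ {d : ℕ} {b : (Fin d → ℕ) → F},
      (∀ z : Fin d → ℂ, (∀ i, ‖z i‖ < r) → HasSum (fun α => (∏ i, z i ^ α i) • b α) 0) → b = 0
  | 0, b, h => by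
    funext α
    have hsum := (h 0 (fun i => i.elim0)).unique (hasSum_fintype _)
    simp only [Finset.univ_eq_empty, Finset.prod_empty, one_smul, Fintype.sum_unique] at hsum
    exact (congrArg b (Subsingleton.elim _ _)).trans hsum.symm
  | d + 1, b, h => by
    have hcons (z : Fin d → ℂ) (hz : ∀ i, ‖z i‖ < r) (t : ℂ) (ht : ‖t‖ < r) :=
      hasSum_cons (h (Fin.cons t z) (Fin.cases ht hz))
    have hsummable (z : Fin d → ℂ) (hz : ∀ i, ‖z i‖ < r) (n : ℕ) :
        Summable fun α : Fin d → ℕ => (∏ i, z i ^ α i) • b (Fin.cons n α) := by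
      obtain ⟨t, ht0, ht⟩ := NormedField.exists_norm_lt ℂ hr
      refine (((hcons z hz t ht).summable.prod_factor n).const_smul (t ^ n)⁻¹).congr fun α => ?_
      exact inv_smul_smul₀ (pow_ne_zero n (norm_pos_iff.1 ht0)) _
    have hslice (n : ℕ) : (fun α : Fin d → ℕ => b (Fin.cons n α)) = 0 := by
      refine eq_zero_of_hasSum hr fun z hz => ?_
      have hzero : (fun n => ∑' α : Fin d → ℕ, (∏ i, z i ^ α i) • b (Fin.cons n α)) = 0 :=
        eq_zero_of_hasSum_pow hr fun t ht =>
          (hcons z hz t ht).prod_fiberwise fun n => (hsummable z hz n).hasSum.const_smul (t ^ n)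
      simpa only [congrFun hzero n, Pi.zero_apply] using (hsummable z hz n).hasSum
    funext α
    rw [← Fin.cons_self_tail α]
    exact congrFun (hslice _) _

end uniqueness

theorem differentiableOn_tsum_of_summable_norm {ι X F : Type*} [NormedAddCommGroup X]
    [NormedSpace ℂ X] [NormedAddCommGroup F] [NormedSpace ℂ F] [CompleteSpace F] {f : ι → X → F}
    {u : ι → ℝ} {U : Set X} (hu : Summable u) (hf : ∀ n, DifferentiableOn ℂ (f n) U)
    (hU : IsOpen U) (hfu : ∀ n, ∀ y ∈ U, ‖f n y‖ ≤ u n) :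
    DifferentiableOn ℂ (fun x => ∑' n, f n x) U := by
  intro x hx
  obtain ⟨ε, hε, hball⟩ := Metric.isOpen_iff.1 hU x hx
  have hsub {y : X} (hy : y ∈ Metric.ball x (ε / 2)) : Metric.ball y (ε / 2) ⊆ U :=
    (Metric.ball_subset_ball' (by linarith [Metric.mem_ball.1 hy])).trans hball
  have hcauchy (n : ι) (y : X) (hy : y ∈ Metric.ball x (ε / 2)) :
      ‖fderiv ℂ (f n) y‖ ≤ (u n + u n) / (ε / 2) := by
    refine Complex.norm_fderiv_le_div_of_mapsTo_ball ((hf n).mono (hsub hy)) (fun w hw => ?_)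
      (half_pos hε)
    rw [Metric.mem_closedBall, dist_eq_norm]
    exact (norm_sub_le _ _).trans (add_le_add (hfu n w (hsub hy hw))
      (hfu n y (hsub hy (Metric.mem_ball_self (half_pos hε)))))
  let _ : NormedSpace ℝ X := NormedSpace.restrictScalars ℝ ℂ X
  exact (hasFDerivAt_tsum_of_isPreconnected ((hu.add hu).div_const (ε / 2)) Metric.isOpen_ball
    (convex_ball x (ε / 2)).isPreconnected
    (fun n y hy => ((hf n).differentiableAt (hU.mem_nhds
      (hsub hy (Metric.mem_ball_self (half_pos hε))))).hasFDerivAt) hcauchy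
    (Metric.mem_ball_self (half_pos hε)) (hu.of_norm_bounded fun n => hfu n x hx)
    (Metric.mem_ball_self (half_pos hε))).differentiableAt.differentiableWithinAt

end MultiPowerSeries

namespace MultiIndex

variable {ι : Type*} [Fintype ι] [DecidableEq ι]

theorem sum_add_single (β : ι → ℕ) (j : ι) :
    ∑ i, (β + Pi.single j 1 : ι → ℕ) i = (∑ i, β i) + 1 := by
  simp [Finset.sum_add_distrib]

theorem prod_pow_add_single {M : Type*} [CommMonoid M] (z : ι → M) (β : ι → ℕ) (j : ι) :
    ∏ i, z i ^ (β + Pi.single j 1 : ι → ℕ) i = z j * ∏ i, z i ^ β i := by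
  have hsingle : ∏ i, z i ^ (Pi.single j 1 : ι → ℕ) i = z j := by simp [Pi.single_apply]
  simp_rw [Pi.add_apply, pow_add, Finset.prod_mul_distrib, hsingle, mul_comm]

theorem prod_factorial_add_single (β : ι → ℕ) (j : ι) :
    ∏ i, ((β + Pi.single j 1 : ι → ℕ) i).factorial = (β j + 1) * ∏ i, (β i).factorial := by
  rw [Fintype.prod_eq_mul_prod_compl j, Fintype.prod_eq_mul_prod_compl j fun i => (β i).factorial,
    ← mul_assoc]
  congr 1
  · simp [Nat.factorial_succ]
  · refine Finset.prod_congr rfl fun i hi => ?_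
    simp [show i ≠ j by simpa using hi]

omit [DecidableEq ι] in
theorem factorial_sum_le (α : ι → ℕ) :
    (∑ i, α i).factorial ≤ Fintype.card ι ^ (∑ i, α i) * ∏ i, (α i).factorial := by
  classical
  have hle : Nat.multinomial Finset.univ α ≤ Fintype.card ι ^ ∑ i, α i := by
    have hsum := Finset.sum_pow_eq_sum_piAntidiag Finset.univ (fun _ : ι => 1) (∑ i, α i)
    simp only [Finset.sum_const, Finset.card_univ, smul_eq_mul, mul_one, one_pow,
      Finset.prod_const_one, Nat.cast_id] at hsum
    rw [hsum]
    exact Finset.single_le_sum (f := Nat.multinomial Finset.univ) (fun _ _ => Nat.zero_le _)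
      (by simp)
  rw [← Nat.multinomial_spec, mul_comm]
  gcongr

omit [Fintype ι] in
theorem exists_eq_add_single {α : ι → ℕ} {j : ι} (hj : α j ≠ 0) :
    ∃ β : ι → ℕ, α = β + Pi.single j 1 := by
  refine ⟨α - Pi.single j 1, (tsub_add_cancel_of_le fun i => ?_).symm⟩
  rcases eq_or_ne i j with rfl | hi
  · simpa using Nat.one_le_iff_ne_zero.2 hj
  · simp [hi]

omit [Fintype ι] in
@[elab_as_elim]
theorem induction_add_single [Finite ι] {P : (ι → ℕ) → Prop} (zero : P 0)
    (add_single : ∀ β j, P β → P (β + Pi.single j 1)) (α : ι → ℕ) : P α := by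
  have := Fintype.ofFinite ι
  induction hn : ∑ i, α i generalizing α with
  | zero =>
    rwa [show α = 0 from funext fun i => Finset.sum_eq_zero_iff.1 hn i (Finset.mem_univ i)]
  | succ n ih =>
    obtain ⟨j, -, hj⟩ := Finset.exists_ne_zero_of_sum_ne_zero (hn.trans_ne n.succ_ne_zero)
    obtain ⟨β, rfl⟩ := exists_eq_add_single hj
    exact add_single β j (ih β (Nat.succ_injective ((sum_add_single β j).symm.trans hn)))

end MultiIndex

section multiPow

variable {M : Type*} [Monoid M] {d : ℕ} {S : Fin d → M}

/-- The power `S^α = S_1^{α_1} ⋯ S_d^{α_d}` of a tuple of elements of a monoid, with the factors in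
this order. -/
def multiPow (S : Fin d → M) (α : Fin d → ℕ) : M :=
  (List.ofFn fun i => S i ^ α i).prod

theorem multiPow_zero (S : Fin d → M) : multiPow S 0 = 1 := by
  simp [multiPow]

theorem multiPow_add_single (hS : ∀ i j, Commute (S i) (S j)) (α : Fin d → ℕ) (j : Fin d) :
    multiPow S (α + Pi.single j 1) = S j * multiPow S α := by
  have cons {n : ℕ} (R : Fin (n + 1) → M) (β : Fin (n + 1) → ℕ) :
      multiPow R β = R 0 ^ β 0 * multiPow (Fin.tail R) (Fin.tail β) := by
    simp [multiPow, Fin.tail]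
  induction d with
  | zero => exact j.elim0
  | succ d ih =>
    rw [cons, cons]
    cases j using Fin.cases with
    | zero =>
      have htail : Fin.tail (α + Pi.single 0 1) = Fin.tail α := by
        funext i
        simp [Fin.tail]
      simp [htail, pow_succ', mul_assoc]
    | succ j =>
      have htail : Fin.tail (α + Pi.single j.succ 1) = Fin.tail α + Pi.single j 1 := by
        funext i
        simp [Fin.tail, Pi.single_apply]
      have hzero : (α + Pi.single j.succ 1 : Fin (d + 1) → ℕ) 0 = α 0 := by simp
      have hcomm : S 0 ^ α 0 * Fin.tail S j = Fin.tail S j * S 0 ^ α 0 :=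
        (hS 0 j.succ).pow_left _
      rw [htail, hzero, ih (S := Fin.tail S) (fun _ _ => hS _ _), ← mul_assoc, hcomm, mul_assoc]
      rfl

end multiPow

theorem norm_multiPow_le {A : Type*} [NormedRing A] {d : ℕ} {S : Fin d → A}
    (hS : ∀ i j, Commute (S i) (S j)) {B : ℝ} (hB : ∀ i, ‖S i‖ ≤ B) (h1 : ‖(1 : A)‖ ≤ 1)
    (α : Fin d → ℕ) : ‖multiPow S α‖ ≤ B ^ ∑ i, α i := by
  induction α using MultiIndex.induction_add_single with
  | zero => simpa [multiPow_zero] using h1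
  | add_single β j ih =>
    rw [multiPow_add_single hS, MultiIndex.sum_add_single, pow_succ']
    exact (norm_mul_le _ _).trans
      (mul_le_mul (hB j) ih (norm_nonneg _) ((norm_nonneg _).trans (hB j)))

namespace AnalyticModel

open Filter Topology
open scoped InnerProductSpace ComplexConjugate

variable {d : ℕ} {K : Type*} [NormedAddCommGroup K] [InnerProductSpace ℂ K] [CompleteSpace K]
  {E : Type*} [NormedAddCommGroup E] [InnerProductSpace ℂ E] [CompleteSpace E] {ι : Type*}
  [Fintype ι] (S : Fin d → K →L[ℂ] K) (J : E →ₗᵢ[ℂ] K) (L : ι → Submodule ℂ E)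
  [∀ i, (L i).HasOrthogonalProjection] (a : ι → (Fin d → ℕ) → ℝ)

omit [CompleteSpace K] [CompleteSpace E] [Fintype ι] [∀ i, (L i).HasOrthogonalProjection] in
/-- The image of the embedding `J` is a wandering subspace of the commuting tuple `S`, it generates
`K`, and `E` is the orthogonal sum of the subspaces `L i`. On `J (L i)` the power `S^α` multiplies
the squares of the norms by `(a i α)⁻¹`, and `a i α` grows at most exponentially in `α`. -/
structure IsWanderingSum : Prop where
  commute : ∀ i j, Commute (S i) (S j)
  ne_zero : ∀ i α, a i α ≠ 0
  bound : ∃ C R : ℝ, 0 ≤ R ∧ ∀ i α, |a i α| ≤ C * R ^ ∑ j, α j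
  orthogonal : Pairwise fun i j => L i ⟂ L j
  inner_pow : ∀ i, ∀ y ∈ L i, ∀ (x : E) (α β : Fin d → ℕ),
    ⟪multiPow S α (J x), multiPow S β (J y)⟫_ℂ =
      if α = β then ((a i α)⁻¹ : ℂ) * ⟪x, y⟫_ℂ else 0
  total : ∀ f : K, (∀ i, ∀ y ∈ L i, ∀ α, ⟪multiPow S α (J y), f⟫_ℂ = 0) → f = 0

/-- The operator `∑ i, a i α • S^α J P_{L i}` from `E` to `K`. By `IsWanderingSum.inner_pow` these
operators form a system dual to the operators `S^α J`. -/
noncomputable def dualPow (α : Fin d → ℕ) : E →L[ℂ] K :=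
  ∑ i, (a i α : ℂ) • (multiPow S α ∘L J.toContinuousLinearMap ∘L (L i).starProjection)

/-- The coefficient of index `α` of the power series representing a vector. -/
noncomputable def coeff (α : Fin d → ℕ) : K →L[ℂ] E :=
  ContinuousLinearMap.adjoint (dualPow S J L a α)

/-- The evaluation at `z` of the power series representing a vector. -/
noncomputable def evalAt (z : EuclideanSpace ℂ (Fin d)) : K →L[ℂ] E :=
  ∑' α, (∏ i, z i ^ α i) • coeff S J L a α

variable {S J L a}

omit [CompleteSpace K] [CompleteSpace E] in
theorem norm_dualPow_le {α : Fin d → ℕ} {A B : ℝ} (hA : ∀ i, |a i α| ≤ A)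
    (hB : ‖multiPow S α‖ ≤ B) : ‖dualPow S J L a α‖ ≤ Fintype.card ι * (A * B) := by
  have hB0 : 0 ≤ B := (norm_nonneg _).trans hB
  have hterm (i : ι) :
      ‖(a i α : ℂ) • (multiPow S α ∘L J.toContinuousLinearMap ∘L (L i).starProjection)‖
        ≤ A * B := by
    rw [norm_smul, Complex.norm_real, Real.norm_eq_abs]
    refine mul_le_mul (hA i) ?_ (norm_nonneg _) ((abs_nonneg _).trans (hA i))
    calc ‖multiPow S α ∘L J.toContinuousLinearMap ∘L (L i).starProjection‖
        ≤ ‖multiPow S α‖ * (‖J.toContinuousLinearMap‖ * ‖(L i).starProjection‖) := by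
          grw [ContinuousLinearMap.opNorm_comp_le, ContinuousLinearMap.opNorm_comp_le]
      _ ≤ B * (1 * 1) := by
          gcongr
          exacts [J.norm_toContinuousLinearMap_le, Submodule.starProjection_norm_le _]
      _ = B := by rw [one_mul, mul_one]
  simpa [dualPow] using norm_sum_le_of_le Finset.univ fun i _ => hterm i

namespace IsWanderingSum

variable (h : IsWanderingSum S J L a)

include h

omit [CompleteSpace K] [CompleteSpace E] [Fintype ι] in
theorem starProjection_eq_zero {i j : ι} (hij : j ≠ i) {y : E} (hy : y ∈ L i) :
    (L j).starProjection y = 0 := by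
  rw [Submodule.starProjection_apply_eq_zero_iff]
  exact (h.orthogonal hij.symm) hy

omit [CompleteSpace K] [CompleteSpace E] in
theorem dualPow_apply {i : ι} {y : E} (hy : y ∈ L i) (α : Fin d → ℕ) :
    dualPow S J L a α y = (a i α : ℂ) • multiPow S α (J y) := by
  simp only [dualPow, _root_.sum_apply, _root_.smul_apply, ContinuousLinearMap.comp_apply]
  rw [Fintype.sum_eq_single i fun j hj => by simp [h.starProjection_eq_zero hj hy],
    Submodule.starProjection_eq_self_iff.2 hy, LinearIsometry.coe_toContinuousLinearMap]

omit [CompleteSpace K] [CompleteSpace E] [Fintype ι] [∀ i, (L i).HasOrthogonalProjection] in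
theorem eq_zero_of_inner_eq_zero {x : E} (hx : ∀ i, ∀ y ∈ L i, ⟪y, x⟫_ℂ = 0) : x = 0 := by
  refine (map_eq_zero_iff J J.injective).1 (h.total _ fun i y hy α => ?_)
  have hpow := h.inner_pow i y hy x 0 α
  rw [multiPow_zero, inner_eq_zero_symm.1 (hx i y hy)] at hpow
  rw [inner_eq_zero_symm]
  simpa using hpow

omit [CompleteSpace K] [CompleteSpace E] [Fintype ι] [∀ i, (L i).HasOrthogonalProjection] in
theorem ext_inner_left {x x' : E} (hx : ∀ i, ∀ y ∈ L i, ⟪y, x⟫_ℂ = ⟪y, x'⟫_ℂ) : x = x' :=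
  sub_eq_zero.1 <| h.eq_zero_of_inner_eq_zero fun i y hy => by
    rw [inner_sub_right, hx i y hy, sub_self]

omit [CompleteSpace K] [CompleteSpace E] in
theorem sum_starProjection (x : E) : ∑ i, (L i).starProjection x = x := by
  refine h.ext_inner_left fun i y hy => ?_
  simp_rw [inner_sum, ← Submodule.inner_starProjection_left_eq_right]
  rw [Fintype.sum_eq_single i fun j hj => by rw [h.starProjection_eq_zero hj hy, inner_zero_left],
    Submodule.starProjection_eq_self_iff.2 hy]

theorem coeff_pow {i : ι} {y : E} (hy : y ∈ L i) (α β : Fin d → ℕ) :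
    coeff S J L a α (multiPow S β (J y)) = if α = β then y else 0 := by
  refine h.ext_inner_left fun j x hx => ?_
  rw [coeff, ContinuousLinearMap.adjoint_inner_right, h.dualPow_apply hx, inner_smul_left,
    h.inner_pow i y hy x]
  split_ifs with hαβ
  · rcases eq_or_ne j i with rfl | hj
    · rw [Complex.conj_ofReal, mul_inv_cancel_left₀]
      exact_mod_cast h.ne_zero _ _
    · simp [(h.orthogonal hj).inner_eq hx hy]
  · simp

theorem eq_zero_of_coeff {f : K} (hf : ∀ α, coeff S J L a α f = 0) : f = 0 := by
  refine h.total f fun i y hy α => ?_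
  have hinner : ⟪y, coeff S J L a α f⟫_ℂ = 0 := by rw [hf, inner_zero_right]
  rw [coeff, ContinuousLinearMap.adjoint_inner_right, h.dualPow_apply hy, inner_smul_left] at hinner
  exact (mul_eq_zero.1 hinner).resolve_left (by simpa using h.ne_zero i α)

theorem exists_norm_coeff_le :
    ∃ C R : ℝ, 0 ≤ R ∧ ∀ α, ‖coeff S J L a α‖ ≤ C * R ^ ∑ j, α j := by
  obtain ⟨C, R, hR, ha⟩ := h.bound
  have hS : ∀ j, ‖S j‖ ≤ ∑ i, ‖S i‖ := fun j =>
    Finset.single_le_sum (f := fun i => ‖S i‖) (fun _ _ => norm_nonneg _) (Finset.mem_univ j)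
  refine ⟨Fintype.card ι * C, R * ∑ i, ‖S i‖, by positivity, fun α => ?_⟩
  rw [coeff, LinearIsometryEquiv.norm_map, mul_pow, mul_assoc, ← mul_assoc C]
  exact norm_dualPow_le (fun i => ha i α)
    (norm_multiPow_le h.commute hS ContinuousLinearMap.norm_id_le α)

theorem exists_summable_bound : ∃ r > 0, ∃ u : (Fin d → ℕ) → ℝ, Summable u ∧
    ∀ z ∈ Metric.ball (0 : EuclideanSpace ℂ (Fin d)) r, ∀ α,
      ‖(∏ i, z i ^ α i) • coeff S J L a α‖ ≤ u α := by
  obtain ⟨C, R, hR, hcoeff⟩ := h.exists_norm_coeff_le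
  have hρ : (R + 1)⁻¹ / 2 * R < 1 := by
    field_simp
    linarith
  refine ⟨(R + 1)⁻¹ / 2, by positivity, _,
    (MultiPowerSeries.summable_pow_sum d (by positivity) hρ).mul_left C, fun z hz α => ?_⟩
  have hzi (i : Fin d) : ‖z i‖ ≤ (R + 1)⁻¹ / 2 :=
    (PiLp.norm_apply_le z i).trans (mem_ball_zero_iff.1 hz).le
  rw [norm_smul, mul_pow, mul_left_comm]
  exact mul_le_mul (MultiPowerSeries.norm_prod_pow_le hzi α) (hcoeff α) (norm_nonneg _)
    (by positivity)

section evaluation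

variable {z : EuclideanSpace ℂ (Fin d)} (hz : Summable fun α => (∏ i, z i ^ α i) • coeff S J L a α)

include hz

omit h in
theorem hasSum_evalAt (f : K) :
    HasSum (fun α => (∏ i, z i ^ α i) • coeff S J L a α f) (evalAt S J L a z f) :=
  hz.hasSum.mapL (ContinuousLinearMap.apply ℂ E f)

theorem evalAt_pow {i : ι} {y : E} (hy : y ∈ L i) (β : Fin d → ℕ) :
    evalAt S J L a z (multiPow S β (J y)) = (∏ i, z i ^ β i) • y := by
  refine (hasSum_evalAt hz _).unique ?_
  simp_rw [h.coeff_pow hy]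
  simpa only [if_true] using hasSum_single
    (f := fun α : Fin d → ℕ => (∏ i, z i ^ α i) • if α = β then y else 0) β
    (fun α hα => by rw [if_neg hα, smul_zero])

theorem evalAt_shift (j : Fin d) (f : K) :
    evalAt S J L a z (S j f) = z j • evalAt S J L a z f := by
  have hcomp : evalAt S J L a z ∘L S j = z j • evalAt S J L a z := by
    apply ContinuousLinearMap.adjoint.injective
    ext1 x
    refine sub_eq_zero.1 (h.total _ fun i y hy α => ?_)
    rw [inner_sub_right, ContinuousLinearMap.adjoint_inner_right,
      ContinuousLinearMap.adjoint_inner_right, ContinuousLinearMap.comp_apply,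
      _root_.smul_apply, h.evalAt_pow hz hy, ← mul_apply_eq_comp,
      ← multiPow_add_single h.commute, h.evalAt_pow hz hy,
      MultiIndex.prod_pow_add_single, smul_smul, sub_self]
  exact congrArg (fun A => A f) hcomp

theorem evalAt_adjoint {w : EuclideanSpace ℂ (Fin d)}
    (hw : Summable fun α => (∏ i, w i ^ α i) • coeff S J L a α) {i : ι} {y : E} (hy : y ∈ L i) :
    evalAt S J L a z (ContinuousLinearMap.adjoint (evalAt S J L a w) y) =
      (∑' α, (a i α : ℂ) * (∏ i, z i ^ α i) * ∏ i, (conj (w i)) ^ α i) • y := by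
  have hadjoint : HasSum (fun α => ContinuousLinearMap.adjoint ((∏ i, w i ^ α i) • coeff S J L a α))
      (ContinuousLinearMap.adjoint (evalAt S J L a w)) :=
    hw.hasSum.map (ContinuousLinearMap.adjoint (𝕜 := ℂ) (E := K) (F := E))
      (LinearIsometryEquiv.continuous _)
  have hterm (α : Fin d → ℕ) : evalAt S J L a z
      (ContinuousLinearMap.adjoint ((∏ i, w i ^ α i) • coeff S J L a α) y) =
      ((a i α : ℂ) * (∏ i, z i ^ α i) * ∏ i, (conj (w i)) ^ α i) • y := by
    rw [map_smulₛₗ, coeff, ContinuousLinearMap.adjoint_adjoint, _root_.smul_apply,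
      h.dualPow_apply hy, map_smul, map_smul, h.evalAt_pow hz hy, smul_smul, smul_smul]
    simp only [map_prod, map_pow]
    ring_nf
  have hsum := (evalAt S J L a z).hasSum (hadjoint.mapL (ContinuousLinearMap.apply ℂ K y))
  simp only [ContinuousLinearMap.apply_apply, hterm] at hsum
  rcases eq_or_ne y 0 with rfl | hy0
  · simp
  have hmap := Topology.IsClosedEmbedding.map_tsum
    (fun α : Fin d → ℕ => (a i α : ℂ) * (∏ i, z i ^ α i) * ∏ i, (conj (w i)) ^ α i)
    (L := .unconditional _) (g := LinearMap.toSpanSingleton ℂ E y) (isClosedEmbedding_smul_left hy0)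
  exact hsum.tsum_eq.symm.trans hmap.symm

end evaluation

theorem eq_zero_of_evalAt {r : ℝ} (hr : 0 < r)
    (hconv : ∀ z ∈ Metric.ball (0 : EuclideanSpace ℂ (Fin d)) r,
      Summable fun α => (∏ i, z i ^ α i) • coeff S J L a α)
    {f : K} (hf : ∀ z ∈ Metric.ball (0 : EuclideanSpace ℂ (Fin d)) r, evalAt S J L a z f = 0) :
    f = 0 := by
  obtain ⟨ρ, hρ, hball⟩ : ∃ ρ > 0, ∀ z : Fin d → ℂ, (∀ i, ‖z i‖ < ρ) →
      WithLp.toLp 2 z ∈ Metric.ball (0 : EuclideanSpace ℂ (Fin d)) r := by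
    obtain ⟨ρ, hρ, hsub⟩ :=
      Metric.continuous_iff.1 (PiLp.continuous_toLp 2 fun _ : Fin d => ℂ) 0 r hr
    refine ⟨ρ, hρ, fun z hz => hsub z ?_⟩
    rwa [dist_zero_right, pi_norm_lt_iff hρ]
  refine h.eq_zero_of_coeff fun α => ?_
  refine congrFun (MultiPowerSeries.eq_zero_of_hasSum (b := fun α => coeff S J L a α f) hρ
    fun z hz => ?_) α
  rw [← hf _ (hball z hz)]
  exact hasSum_evalAt (hconv _ (hball z hz)) f

/-- The Hilbert space of the tuple, regarded as a space of functions on a ball on which the power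
series of all vectors converge. -/
noncomputable abbrev rkhs {r : ℝ} (hr : 0 < r)
    (hconv : ∀ z ∈ Metric.ball (0 : EuclideanSpace ℂ (Fin d)) r,
      Summable fun α => (∏ i, z i ^ α i) • coeff S J L a α) :
    RKHS ℂ K (Metric.ball (0 : EuclideanSpace ℂ (Fin d)) r) E where
  coeCLM := ContinuousLinearMap.pi fun z => evalAt S J L a z
  coeCLM_injective := (injective_iff_map_eq_zero (ContinuousLinearMap.pi fun z :
      Metric.ball (0 : EuclideanSpace ℂ (Fin d)) r => evalAt S J L a z)).2 fun _ hf =>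
    h.eq_zero_of_evalAt hr hconv fun z hz => congrFun hf ⟨z, hz⟩

theorem kernel_rkhs {r : ℝ} (hr : 0 < r)
    (hconv : ∀ z ∈ Metric.ball (0 : EuclideanSpace ℂ (Fin d)) r,
      Summable fun α => (∏ i, z i ^ α i) • coeff S J L a α)
    (z w : Metric.ball (0 : EuclideanSpace ℂ (Fin d)) r) :
    letI := h.rkhs hr hconv
    RKHS.kernel K z w =
      ∑ i, (∑' α, (a i α : ℂ) * (∏ i, (z : EuclideanSpace ℂ (Fin d)) i ^ α i) *
        ∏ i, (conj ((w : EuclideanSpace ℂ (Fin d)) i)) ^ α i) • (L i).starProjection := by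
  let _ := h.rkhs hr hconv
  ext1 x
  have hkernel : RKHS.kernel K z w x =
      evalAt S J L a z (ContinuousLinearMap.adjoint (evalAt S J L a w) x) :=
    (RKHS.kerFun_apply K w x z).symm
  rw [hkernel]
  conv_lhs => rw [← h.sum_starProjection x]
  simp only [map_sum, _root_.sum_apply, _root_.smul_apply]
  exact Finset.sum_congr rfl fun i _ => h.evalAt_adjoint (hconv _ z.2) (hconv _ w.2)
    (Submodule.starProjection_apply_mem _ _)

omit h in
theorem differentiableOn_evalAt {U : Set (EuclideanSpace ℂ (Fin d))} (hU : IsOpen U)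
    {u : (Fin d → ℕ) → ℝ} (hu : Summable u)
    (hbound : ∀ z ∈ U, ∀ α, ‖(∏ i, z i ^ α i) • coeff S J L a α‖ ≤ u α) (f : K) :
    DifferentiableOn ℂ (fun z => evalAt S J L a z f) U := by
  have hterm (α : Fin d → ℕ) : Differentiable ℂ fun z : EuclideanSpace ℂ (Fin d) =>
      (∏ i, z i ^ α i) • coeff S J L a α f := by
    fun_prop
  refine (MultiPowerSeries.differentiableOn_tsum_of_summable_norm (hu.mul_right ‖f‖)
    (fun α => (hterm α).differentiableOn) hU fun α z hz => ?_).congr fun z hz => ?_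
  · exact ContinuousLinearMap.le_of_opNorm_le _ (hbound z hz α) f
  · exact (hasSum_evalAt (hu.of_norm_bounded (hbound z hz)) f).tsum_eq.symm

theorem eventually_exists_rkhs : ∀ᶠ r in 𝓝[>] (0 : ℝ),
    ∃ _ : RKHS ℂ K (Metric.ball (0 : EuclideanSpace ℂ (Fin d)) r) E,
      (∀ f : K, ∃ g : EuclideanSpace ℂ (Fin d) → E,
        DifferentiableOn ℂ g (Metric.ball 0 r) ∧
          ∀ z : Metric.ball (0 : EuclideanSpace ℂ (Fin d)) r, f z = g z) ∧
      (∀ (j : Fin d) (f : K) (z : Metric.ball (0 : EuclideanSpace ℂ (Fin d)) r),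
        S j f z = (z : EuclideanSpace ℂ (Fin d)) j • f z) ∧
      ∀ z w : Metric.ball (0 : EuclideanSpace ℂ (Fin d)) r, RKHS.kernel K z w =
        ∑ i, (∑' α, (a i α : ℂ) * (∏ i, (z : EuclideanSpace ℂ (Fin d)) i ^ α i) *
          ∏ i, (conj ((w : EuclideanSpace ℂ (Fin d)) i)) ^ α i) • (L i).starProjection := by
  obtain ⟨r₀, hr₀, u, hu, hbound⟩ := h.exists_summable_bound
  filter_upwards [Ioc_mem_nhdsGT hr₀] with r ⟨hr, hr_le⟩
  replace hbound := fun z hz => hbound z (Metric.ball_subset_ball hr_le hz)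
  have hconv := fun z hz => hu.of_norm_bounded (hbound z hz)
  exact ⟨h.rkhs hr hconv,
    fun f => ⟨_, differentiableOn_evalAt Metric.isOpen_ball hu hbound f, fun _ => rfl⟩,
    fun j f z => h.evalAt_shift (hconv z z.2) j f, h.kernel_rkhs hr hconv⟩

end IsWanderingSum

end AnalyticModel

namespace RootedDirectedTree

variable {V : Type u} (T : RootedDirectedTree V)

theorem ne_root_of_adj {v w : V} (h : T.Adj v w) : w ≠ T.root :=
  fun e => T.root_no_parent v (e ▸ h)

section depth

theorem mem_iterate_chiSet_depth (v : V) : v ∈ T.chiSet^[T.depth v] {T.root} :=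
  (T.existsUnique_depth v).choose_spec.1

theorem depth_root : T.depth T.root = 0 :=
  (T.existsUnique_depth T.root).unique (T.mem_iterate_chiSet_depth T.root) rfl

theorem depth_of_adj {v w : V} (h : T.Adj v w) : T.depth w = T.depth v + 1 := by
  refine (T.existsUnique_depth w).unique (T.mem_iterate_chiSet_depth w) ?_
  rw [Function.iterate_succ_apply']
  exact ⟨v, T.mem_iterate_chiSet_depth v, h⟩

theorem finite_setOf_depth_le [T.IsLocallyFinite] (n : ℕ) : {v | T.depth v ≤ n}.Finite := by
  have finite_iterate (k : ℕ) : (T.chiSet^[k] {T.root}).Finite := by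
    induction k with
    | zero => exact Set.finite_singleton _
    | succ k ih =>
      rw [Function.iterate_succ_apply']
      refine (ih.biUnion fun v _ => IsLocallyFinite.finite_chi (T := T) v).subset ?_
      rintro w ⟨v, hv, hw⟩
      exact Set.mem_biUnion hv hw
  refine ((Set.finite_Iic n).biUnion fun k _ => finite_iterate k).subset fun v hv => ?_
  exact Set.mem_biUnion (x := T.depth v) hv (T.mem_iterate_chiSet_depth v)

theorem exists_depth_le_of_branchingIndex_lt_top (h : T.branchingIndex < ⊤) :
    ∃ b : ℕ, ∀ v ∈ T.branching, T.depth v ≤ b := by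
  rcases T.branching.eq_empty_or_nonempty with hempty | hne
  · simp [hempty]
  · rw [branchingIndex, if_pos hne, ENat.add_lt_top] at h
    obtain ⟨b, hb⟩ := ENat.ne_top_iff_exists.1 h.2.ne
    refine ⟨b, fun v hv => ?_⟩
    rw [← ENat.natCast_le_natCast, hb]
    exact le_iSup₂ (f := fun w (_ : w ∈ T.branching) => (T.depth w : ℕ∞)) v hv

end depth

section sib

variable {T}

theorem mem_sib_iff {v w : V} :
    w ∈ T.sib v ↔ v ≠ T.root ∧ w ≠ T.root ∧ T.par w = T.par v := by
  constructor
  · rintro ⟨p, hv, hw⟩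
    exact ⟨T.ne_root_of_adj hv, T.ne_root_of_adj hw, by rw [T.par_eq hv, T.par_eq hw]⟩
  · rintro ⟨hv, hw, hpar⟩
    exact ⟨_, T.adj_par hv, hpar ▸ T.adj_par hw⟩

theorem depth_of_mem_sib {v w : V} (h : w ∈ T.sib v) : T.depth w = T.depth v := by
  obtain ⟨p, hv, hw⟩ := h
  rw [T.depth_of_adj hv, T.depth_of_adj hw]

end sib

section children

/-- The finset of the children of a vertex of a locally finite tree. -/
noncomputable def chiFinset [T.IsLocallyFinite] (v : V) : Finset V :=
  (IsLocallyFinite.finite_chi (T := T) v).toFinset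

variable {T} in
@[simp]
theorem mem_chiFinset [T.IsLocallyFinite] {v w : V} : w ∈ T.chiFinset v ↔ T.Adj v w :=
  Set.Finite.mem_toFinset _

/-- The factor of the weight `λ_j(w)`, `w ∈ Chi_j(v)`, which only depends on the coordinate
`v_j`. -/
noncomputable def branchFactor (v : V) : ℝ :=
  √((T.depth v + 1) / (T.chi v).ncard)

theorem ncard_chi [T.IsLocallyFinite] (v : V) : (T.chi v).ncard = (T.chiFinset v).card :=
  Set.ncard_eq_toFinset_card _ _

variable {T} in
theorem IsLeafless.card_chiFinset_pos [T.IsLocallyFinite] (hT : T.IsLeafless) (v : V) :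
    0 < (T.chiFinset v).card := by
  obtain ⟨w, hw⟩ := hT v
  exact Finset.card_pos.2 ⟨w, mem_chiFinset.2 hw⟩

variable {T} in
theorem IsLeafless.branchFactor_pos [T.IsLocallyFinite] (hT : T.IsLeafless) (v : V) :
    0 < T.branchFactor v := by
  have hcard := hT.card_chiFinset_pos v
  rw [branchFactor, ncard_chi]
  positivity

variable {T} in
theorem IsLeafless.card_mul_branchFactor_sq [T.IsLocallyFinite] (hT : T.IsLeafless) (v : V) :
    (T.chiFinset v).card * T.branchFactor v ^ 2 = T.depth v + 1 := by
  have hcard := hT.card_chiFinset_pos v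
  rw [branchFactor, Real.sq_sqrt (by positivity), ncard_chi]
  field_simp

end children

end RootedDirectedTree

namespace TreeProduct

section kernelCoeff

open Filter Topology

variable {d : ℕ} {c : ℕ → ℝ}

/-- The factor by which `S_j^* S_j` multiplies the functions supported on the vertices of
depth `δ`. -/
noncomputable def growth (c : ℕ → ℝ) (j : Fin d) (δ : Fin d → ℕ) : ℝ :=
  c (∑ i, δ i) / ((∑ i, δ i : ℕ) + d) * (δ j + 1)

theorem kernelCoeff_zero (δ : Fin d → ℕ) : kernelCoeff c δ 0 = 1 := by
  have hne : ((∏ i, (δ i).factorial : ℕ) : ℝ) ≠ 0 :=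
    Nat.cast_ne_zero.2 (Finset.prod_ne_zero_iff.2 fun i _ => Nat.factorial_ne_zero _)
  simpa [kernelCoeff] using div_self hne

theorem kernelCoeff_add_single (hc : ∀ t, 0 < c t) (δ α : Fin d → ℕ) (j : Fin d) :
    kernelCoeff c δ (α + Pi.single j 1) = (growth c j (δ + α))⁻¹ * kernelCoeff c δ α := by
  have hfactorial : ∏ i, (δ i + (α + Pi.single j 1 : Fin d → ℕ) i).factorial =
      (δ j + α j + 1) * ∏ i, (δ i + α i).factorial := by
    simpa only [← add_assoc, Pi.add_apply] using MultiIndex.prod_factorial_add_single (δ + α) j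
  rw [kernelCoeff, MultiIndex.sum_add_single, Finset.prod_range_succ, hfactorial, kernelCoeff,
    growth]
  simp only [Pi.add_apply, Finset.sum_add_distrib]
  have hc' := (hc ((∑ i, δ i) + ∑ i, α i)).ne'
  have hprod : ((∏ i, (δ i + α i).factorial : ℕ) : ℝ) ≠ 0 :=
    Nat.cast_ne_zero.2 (Finset.prod_ne_zero_iff.2 fun i _ => Nat.factorial_ne_zero _)
  generalize (∏ i, (δ i + α i).factorial : ℕ) = p at *
  generalize ∑ i, δ i = s, ∑ i, α i = t at *
  push_cast
  field_simp
  ring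

theorem kernelCoeff_pos (hc : ∀ t, 0 < c t) (δ α : Fin d → ℕ) : 0 < kernelCoeff c δ α := by
  induction α using MultiIndex.induction_add_single with
  | zero => simp [kernelCoeff_zero]
  | add_single β j ih =>
    have hcδ := hc (∑ i, (δ + β) i)
    have hd := Fin.pos j
    rw [kernelCoeff_add_single hc, growth]
    positivity

theorem prod_range_div_le {m : ℝ} (hm : 0 < m) (hmc : ∀ t, m ≤ c t) (s N n : ℕ) :
    ∏ j ∈ Finset.range n, (N + j : ℝ) / c (s + j) ≤ 2 ^ N * (2 / m) ^ n * n.factorial := by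
  have hfactorial : ∏ j ∈ Finset.range n, (N + j) ≤ 2 ^ (N + n) * n.factorial := by
    rw [← Nat.ascFactorial_eq_prod_range, Nat.ascFactorial_eq_factorial_mul_choose', mul_comm]
    gcongr
    exact (Nat.choose_le_two_pow _ _).trans (Nat.pow_le_pow_right two_pos (Nat.sub_le _ _))
  calc ∏ j ∈ Finset.range n, (N + j : ℝ) / c (s + j)
      ≤ ∏ j ∈ Finset.range n, (N + j : ℝ) / m := by
        gcongr with j
        · exact fun j _ => div_nonneg (by positivity) (hm.le.trans (hmc _))
        · exact hmc _
    _ = (∏ j ∈ Finset.range n, (N + j) : ℕ) / m ^ n := by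
        rw [Finset.prod_div_distrib, Finset.prod_const, Finset.card_range]
        push_cast
        rfl
    _ ≤ (2 ^ (N + n) * n.factorial : ℕ) / m ^ n := by gcongr
    _ = 2 ^ N * (2 / m) ^ n * n.factorial := by
        push_cast
        rw [pow_add, div_pow]
        ring

theorem kernelCoeff_le {m : ℝ} (hm : 0 < m) (hmc : ∀ t, m ≤ c t) (δ α : Fin d → ℕ) :
    kernelCoeff c δ α ≤
      (∏ i, (δ i).factorial : ℕ) * 2 ^ (∑ i, δ i + d) * (2 * d / m) ^ ∑ i, α i := by
  have hfactorial : ((∑ i, α i).factorial : ℝ) ≤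
      d ^ (∑ i, α i) * (∏ i, (δ i + α i).factorial : ℕ) := by
    have hle : ∏ i, (α i).factorial ≤ ∏ i, (δ i + α i).factorial :=
      Finset.prod_le_prod' fun i _ => Nat.factorial_le (Nat.le_add_left _ _)
    have hsum := MultiIndex.factorial_sum_le α
    rw [Fintype.card_fin] at hsum
    exact_mod_cast hsum.trans (Nat.mul_le_mul_left _ hle)
  have hpos : (0 : ℝ) < (∏ i, (δ i + α i).factorial : ℕ) :=
    Nat.cast_pos.2 (Finset.prod_pos fun i _ => Nat.factorial_pos _)
  rw [kernelCoeff, div_mul_eq_mul_div, div_le_iff₀ hpos, mul_assoc, mul_assoc]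
  gcongr
  calc ∏ j ∈ Finset.range (∑ i, α i), ((∑ i, δ i : ℕ) + d + j : ℝ) / c (∑ i, δ i + j)
      ≤ 2 ^ (∑ i, δ i + d) * (2 / m) ^ (∑ i, α i) * (∑ i, α i).factorial := by
        simpa using prod_range_div_le hm hmc (∑ i, δ i) (∑ i, δ i + d) (∑ i, α i)
    _ ≤ 2 ^ (∑ i, δ i + d) * (2 / m) ^ (∑ i, α i) *
        (d ^ (∑ i, α i) * (∏ i, (δ i + α i).factorial : ℕ)) := by gcongr
    _ = _ := by
        rw [mul_div_right_comm, mul_pow]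
        ring

theorem summable_kernelTerm {m : ℝ} (hm : 0 < m) (hmc : ∀ t, m ≤ c t) {r : ℝ} (hr : 0 ≤ r)
    (hr1 : r * (2 * d / m) * r < 1) (δ : Fin d → ℕ) (z w : Ball d r) :
    Summable (kernelTerm c δ z w) := by
  have hcoord (z : Ball d r) (i : Fin d) : ‖(z : EuclideanSpace ℂ (Fin d)) i‖ ≤ r :=
    (PiLp.norm_apply_le _ i).trans (mem_ball_zero_iff.1 z.2).le
  refine Summable.of_norm_bounded ((MultiPowerSeries.summable_pow_sum d (by positivity)
    hr1).mul_left ((∏ i, (δ i).factorial : ℕ) * 2 ^ (∑ i, δ i + d) : ℝ)) fun α => ?_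
  have hz := MultiPowerSeries.norm_prod_pow_le (hcoord z) α
  have hw := MultiPowerSeries.norm_prod_pow_le (r := r)
    (z := fun i => starRingEnd ℂ ((w : EuclideanSpace ℂ (Fin d)) i))
    (fun i => by rw [RCLike.norm_conj]; exact hcoord w i) α
  rw [kernelTerm, norm_mul, norm_mul, Complex.norm_real,
    Real.norm_of_nonneg (kernelCoeff_pos (fun t => hm.trans_le (hmc t)) δ α).le]
  calc _ ≤ (∏ i, (δ i).factorial : ℕ) * 2 ^ (∑ i, δ i + d) * (2 * d / m) ^ (∑ i, α i) *
        r ^ (∑ i, α i) * r ^ (∑ i, α i) := by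
        gcongr
        exact kernelCoeff_le hm hmc δ α
    _ = _ := by
        rw [mul_pow, mul_pow]
        ring

theorem eventually_summable_kernelTerm {m : ℝ} (hm : 0 < m) (hmc : ∀ t, m ≤ c t) :
    ∀ᶠ r in 𝓝[>] (0 : ℝ), ∀ (δ : Fin d → ℕ) (z w : Ball d r), Summable (kernelTerm c δ z w) := by
  have hlim : Tendsto (fun r : ℝ => r * (2 * d / m) * r) (𝓝[>] 0) (𝓝 (0 * (2 * d / m) * 0)) :=
    (Continuous.tendsto (by fun_prop) _).mono_left nhdsWithin_le_nhds
  rw [mul_zero] at hlim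
  filter_upwards [hlim.eventually_lt_const one_pos, self_mem_nhdsWithin] with r hr1 hr δ z w
  exact summable_kernelTerm hm hmc (le_of_lt hr) hr1 δ z w

end kernelCoeff

variable {d : ℕ} {V : Fin d → Type u} (T : ∀ j, RootedDirectedTree (V j))

section vertices

variable {T}

theorem par_apply_of_ne {j k : Fin d} (hjk : k ≠ j) (v : ∀ j, V j) : par T j v k = v k :=
  Function.update_of_ne hjk _ _

theorem par_apply_self (j : Fin d) (v : ∀ j, V j) : par T j v j = (T j).par (v j) :=
  Function.update_self _ _ _

theorem par_comm {j k : Fin d} (hjk : j ≠ k) (v : ∀ j, V j) :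
    par T j (par T k v) = par T k (par T j v) := by
  simp only [par, Function.update_of_ne hjk, Function.update_of_ne hjk.symm]
  exact Function.update_comm hjk.symm _ _ _

theorem par_update_self {j : Fin d} {v : ∀ j, V j} {x : V j} (hx : (T j).Adj (v j) x) :
    par T j (Function.update v j x) = v := by
  simp [par, (T j).par_eq hx]

theorem par_update_of_ne {j k : Fin d} (hjk : k ≠ j) (v : ∀ j, V j) (x : V j) :
    par T k (Function.update v j x) = Function.update (par T k v) j x := by
  rw [par, Function.update_of_ne hjk, Function.update_comm hjk.symm, par]

theorem depth_update_of_adj {j : Fin d} {v : ∀ j, V j} {x : V j} (hx : (T j).Adj (v j) x) :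
    depth T (Function.update v j x) = depth T v + Pi.single j 1 := by
  funext i
  rcases eq_or_ne i j with rfl | hi
  · simp [depth, (T i).depth_of_adj hx]
  · simp [depth, hi]

theorem depth_eq_depth_par_add {j : Fin d} {v : ∀ j, V j} (hv : v j ≠ (T j).root) :
    depth T v = depth T (par T j v) + Pi.single j 1 := by
  rw [← depth_update_of_adj (x := v j) (by simpa [par] using (T j).adj_par hv)]
  simp [par]

theorem chi_eq_image (j : Fin d) (v : ∀ j, V j) :
    chi T j v = Function.update v j '' (T j).chi (v j) := by
  ext w
  constructor
  · rintro ⟨hj, hne⟩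
    exact ⟨w j, hj, Function.update_eq_iff.2 ⟨rfl, fun i hi => (hne i hi).symm⟩⟩
  · rintro ⟨x, hx, rfl⟩
    exact ⟨by simpa using hx, fun i hi => Function.update_of_ne hi _ _⟩

theorem ncard_chi (j : Fin d) (v : ∀ j, V j) : (chi T j v).ncard = ((T j).chi (v j)).ncard := by
  rw [chi_eq_image, Set.ncard_image_of_injective _ (Function.update_injective v j)]

end vertices

section weights

/-- The common value of the weights `λ_j(w)`, `w ∈ Chi_j(v)`, written as the product of a factor
depending on `|d_v|` and a factor depending on `v_j`. -/
noncomputable def outWeight (c : ℕ → ℝ) (j : Fin d) (v : ∀ j, V j) : ℝ :=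
  √(c (∑ i, depth T v i) / ((∑ i, depth T v i : ℕ) + d)) * (T j).branchFactor (v j)

variable {T} {c : ℕ → ℝ}

theorem weights_eq_outWeight (hc : ∀ t, 0 < c t) (j : Fin d) (w : ∀ j, V j) :
    weights T c j w = outWeight T c j (par T j w) := by
  have hcw := (hc (∑ i, depth T (par T j w) i)).le
  rw [weights, outWeight, RootedDirectedTree.branchFactor, ncard_chi, Real.sqrt_div hcw,
    Real.sqrt_div hcw, Real.sqrt_div (by positivity), Real.sqrt_div (by positivity), depth]
  ring

theorem outWeight_par_comm (c : ℕ → ℝ) {j k : Fin d} (hjk : j ≠ k) {v : ∀ j, V j}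
    (hj : v j ≠ (T j).root) (hk : v k ≠ (T k).root) :
    outWeight T c j (par T j v) * outWeight T c k (par T k (par T j v)) =
      outWeight T c k (par T k v) * outWeight T c j (par T j (par T k v)) := by
  have hsum : ∑ i, depth T (par T j v) i = ∑ i, depth T (par T k v) i := by
    have h := congrArg (fun δ => ∑ i, δ i)
      ((depth_eq_depth_par_add hj).symm.trans (depth_eq_depth_par_add hk))
    simpa only [MultiIndex.sum_add_single, Nat.add_right_cancel_iff] using h
  simp only [outWeight, par_comm hjk, hsum, par_apply_self, par_apply_of_ne hjk]
  rw [par_apply_of_ne hjk.symm]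
  ring

theorem outWeight_update_of_ne (c : ℕ → ℝ) {j k : Fin d} (hjk : k ≠ j) {v : ∀ j, V j} {x : V j}
    (hx : (T j).Adj (v j) x) :
    outWeight T c k (Function.update v j x) =
      √(c (∑ i, depth T v i + 1) / ((∑ i, depth T v i + 1 : ℕ) + d)) *
        (T k).branchFactor (v k) := by
  rw [outWeight, depth_update_of_adj hx, MultiIndex.sum_add_single, Function.update_of_ne hjk]

variable [∀ j, (T j).IsLocallyFinite] (hl : ∀ j, (T j).IsLeafless) (hc : ∀ t, 0 < c t)

include hl hc

theorem outWeight_pos (j : Fin d) (v : ∀ j, V j) : 0 < outWeight T c j v := by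
  have hcv := hc (∑ i, depth T v i)
  have hbranch := (hl j).branchFactor_pos (v j)
  have hd := Fin.pos j
  unfold outWeight
  positivity

theorem outWeight_sq_mul_card (j : Fin d) (v : ∀ j, V j) :
    outWeight T c j v ^ 2 * ((T j).chiFinset (v j)).card = growth c j (depth T v) := by
  have hcv := hc (∑ i, depth T v i)
  rw [outWeight, mul_pow, mul_assoc, mul_comm (_ ^ 2) (Finset.card _ : ℝ),
    (hl j).card_mul_branchFactor_sq, Real.sq_sqrt (by positivity), growth, depth]

end weights

/-- The sum of a function over `Chi_j(v)`. -/
noncomputable def childSum [∀ j, (T j).IsLocallyFinite] (j : Fin d) (f : (∀ j, V j) → ℂ)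
    (v : ∀ j, V j) : ℂ :=
  ∑ x ∈ (T j).chiFinset (v j), f (Function.update v j x)

section operators

variable {T} {c : ℕ → ℝ} {hcs : BddAbove (Set.range c)}

theorem multishiftOf_apply_of_root {j : Fin d} (f : L2 V) {v : ∀ j, V j}
    (hv : v j = (T j).root) : multishiftOf T c hcs j f v = 0 :=
  if_pos hv

variable (hc : ∀ t, 0 < c t)

include hc

theorem multishiftOf_apply_of_ne_root {j : Fin d} (f : L2 V) {v : ∀ j, V j}
    (hv : v j ≠ (T j).root) :
    multishiftOf T c hcs j f v = outWeight T c j (par T j v) * f (par T j v) := by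
  rw [← weights_eq_outWeight hc]
  exact if_neg hv

theorem multishiftOf_apply_update {j : Fin d} (f : L2 V) {v : ∀ j, V j} {x : V j}
    (hx : (T j).Adj (v j) x) :
    multishiftOf T c hcs j f (Function.update v j x) = outWeight T c j v * f v := by
  rw [multishiftOf_apply_of_ne_root hc f, par_update_self hx]
  rw [Function.update_self]
  exact (T j).ne_root_of_adj hx

theorem commute_multishiftOf (j k : Fin d) :
    Commute (multishiftOf T c hcs j) (multishiftOf T c hcs k) := by
  rcases eq_or_ne j k with rfl | hjk
  · exact Commute.refl _
  ext f v
  rw [mul_apply_eq_comp, mul_apply_eq_comp]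
  by_cases hj : v j = (T j).root
  · rw [multishiftOf_apply_of_root _ hj]
    by_cases hk : v k = (T k).root
    · rw [multishiftOf_apply_of_root _ hk]
    · rw [multishiftOf_apply_of_ne_root hc _ hk,
        multishiftOf_apply_of_root _ (by rwa [par_apply_of_ne hjk]), mul_zero]
  · rw [multishiftOf_apply_of_ne_root hc _ hj]
    by_cases hk : v k = (T k).root
    · rw [multishiftOf_apply_of_root _ hk,
        multishiftOf_apply_of_root _ (by rwa [par_apply_of_ne hjk.symm]), mul_zero]
    · rw [multishiftOf_apply_of_ne_root hc _ hk,
        multishiftOf_apply_of_ne_root hc _ (by rwa [par_apply_of_ne hjk.symm]),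
        multishiftOf_apply_of_ne_root hc _ (by rwa [par_apply_of_ne hjk]),
        par_comm hjk, ← mul_assoc, ← mul_assoc]
      congr 1
      have hweights := outWeight_par_comm c hjk hj hk
      rw [par_comm hjk] at hweights
      exact_mod_cast hweights

variable [∀ j, (T j).IsLocallyFinite]

open scoped InnerProductSpace

theorem adjoint_multishiftOf_apply (j : Fin d) (f : L2 V) (v : ∀ j, V j) :
    ContinuousLinearMap.adjoint (multishiftOf T c hcs j) f v =
      outWeight T c j v * childSum T j f v := by
  classical
  set g := multishiftOf T c hcs j (lp.single 2 v 1)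
  have hsupport (w : ∀ j, V j)
      (hw : w ∉ ((T j).chiFinset (v j)).map ⟨_, Function.update_injective v j⟩) : g w = 0 := by
    by_cases hr : w j = (T j).root
    · exact multishiftOf_apply_of_root _ hr
    · rw [multishiftOf_apply_of_ne_root hc _ hr, lp.single_apply, Pi.single_eq_of_ne, mul_zero]
      rintro rfl
      refine hw (Finset.mem_map.2 ⟨w j, ?_, by simp [par]⟩)
      simpa [par] using (T j).adj_par hr
  have hinner : ⟪g, f⟫_ℂ = ∑ x ∈ (T j).chiFinset (v j),
      ⟪g (Function.update v j x), f (Function.update v j x)⟫_ℂ := by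
    have hsum := hasSum_sum_of_ne_finset_zero (f := fun w => ⟪g w, f w⟫_ℂ)
      (L := .unconditional _) fun w hw => by rw [hsupport w hw, inner_zero_left]
    rw [Finset.sum_map] at hsum
    exact (lp.hasSum_inner g f).unique hsum
  calc ContinuousLinearMap.adjoint (multishiftOf T c hcs j) f v
      = ⟪lp.single 2 v (1 : ℂ), ContinuousLinearMap.adjoint (multishiftOf T c hcs j) f⟫_ℂ := by
        simp [lp.inner_single_left]
    _ = ⟪g, f⟫_ℂ := ContinuousLinearMap.adjoint_inner_right _ _ _
    _ = ∑ x ∈ (T j).chiFinset (v j), outWeight T c j v * f (Function.update v j x) := by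
        rw [hinner]
        refine Finset.sum_congr rfl fun x hx => ?_
        rw [multishiftOf_apply_update hc _ (RootedDirectedTree.mem_chiFinset.1 hx)]
        simp [mul_comm]
    _ = outWeight T c j v * childSum T j f v := (Finset.mul_sum _ _ _).symm

variable (hl : ∀ j, (T j).IsLeafless)

include hl

theorem adjoint_multishiftOf_eq_zero_iff (j : Fin d) (f : L2 V) :
    ContinuousLinearMap.adjoint (multishiftOf T c hcs j) f = 0 ↔ ∀ v, childSum T j f v = 0 := by
  have hweight (v : ∀ j, V j) : (outWeight T c j v : ℂ) ≠ 0 :=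
    Complex.ofReal_ne_zero.2 (outWeight_pos hl hc j v).ne'
  rw [lp.ext_iff, funext_iff]
  refine forall_congr' fun v => ?_
  rw [adjoint_multishiftOf_apply hc, lp.coeFn_zero, Pi.zero_apply,
    mul_eq_zero_iff_left (hweight v)]

theorem mem_jointKernelOf_iff {f : L2 V} :
    f ∈ jointKernelOf T c hcs ↔ ∀ j v, childSum T j f v = 0 := by
  simp only [jointKernelOf, jointKernel, Submodule.mem_iInf, LinearMap.mem_ker]
  exact forall_congr' fun j => adjoint_multishiftOf_eq_zero_iff (hcs := hcs) hc hl j f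

theorem adjoint_multishiftOf_multishiftOf_apply (j : Fin d) (f : L2 V) (v : ∀ j, V j) :
    ContinuousLinearMap.adjoint (multishiftOf T c hcs j) (multishiftOf T c hcs j f) v =
      growth c j (depth T v) * f v := by
  have hsum : childSum T j (multishiftOf T c hcs j f) v =
      ((T j).chiFinset (v j)).card * (outWeight T c j v * f v) := by
    rw [← nsmul_eq_mul, ← Finset.sum_const]
    exact Finset.sum_congr rfl fun x hx =>
      multishiftOf_apply_update hc f (RootedDirectedTree.mem_chiFinset.1 hx)
  rw [adjoint_multishiftOf_apply hc, hsum, ← outWeight_sq_mul_card hl hc]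
  push_cast
  ring

/-- The weights being constant on `Chi_j(v)`, the kernel of `S_j^*` is invariant under `S_k` for
`k ≠ j`. -/
theorem adjoint_multishiftOf_multishiftOf_eq_zero {j k : Fin d} (hjk : k ≠ j) {f : L2 V}
    (hf : ContinuousLinearMap.adjoint (multishiftOf T c hcs j) f = 0) :
    ContinuousLinearMap.adjoint (multishiftOf T c hcs j) (multishiftOf T c hcs k f) = 0 := by
  rw [adjoint_multishiftOf_eq_zero_iff hc hl] at hf ⊢
  intro v
  by_cases hk : v k = (T k).root
  · exact Finset.sum_eq_zero fun x _ => multishiftOf_apply_of_root _ (by simpa [hjk] using hk)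
  · set a : ℝ := √(c (∑ i, depth T (par T k v) i + 1) /
        ((∑ i, depth T (par T k v) i + 1 : ℕ) + d)) * (T k).branchFactor (par T k v k) with ha
    have happly (x : V j) (hx : (T j).Adj (v j) x) :
        multishiftOf T c hcs k f (Function.update v j x) =
          a * f (Function.update (par T k v) j x) := by
      have hx' : (T j).Adj (par T k v j) x := by rwa [par_apply_of_ne hjk.symm]
      rw [multishiftOf_apply_of_ne_root hc _ (by rwa [Function.update_of_ne hjk]),
        par_update_of_ne hjk, outWeight_update_of_ne c hjk hx', ha]
    calc childSum T j (multishiftOf T c hcs k f) v = a * childSum T j f (par T k v) := by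
          rw [childSum, childSum, par_apply_of_ne hjk.symm, Finset.mul_sum]
          exact Finset.sum_congr rfl fun x hx => happly x (RootedDirectedTree.mem_chiFinset.1 hx)
      _ = 0 := by rw [hf, mul_zero]

end operators

section orthogonality

variable {T} {c : ℕ → ℝ} {hcs : BddAbove (Set.range c)} (hc : ∀ t, 0 < c t)

open scoped InnerProductSpace

include hc

theorem depth_of_multiPow_apply_ne_zero {f : L2 V} {δ : Fin d → ℕ}
    (hf : ∀ v, f v ≠ 0 → depth T v = δ) (α : Fin d → ℕ) (v : ∀ j, V j)
    (hv : multiPow (multishiftOf T c hcs) α f v ≠ 0) : depth T v = δ + α := by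
  induction α using MultiIndex.induction_add_single generalizing v with
  | zero => simpa using hf v (by simpa [multiPow_zero] using hv)
  | add_single β j ih =>
    rw [multiPow_add_single (commute_multishiftOf hc), mul_apply_eq_comp] at hv
    have hroot : v j ≠ (T j).root := fun e => hv (multishiftOf_apply_of_root _ e)
    rw [multishiftOf_apply_of_ne_root hc _ hroot] at hv
    rw [depth_eq_depth_par_add hroot, ih _ (right_ne_zero_of_mul hv), add_assoc]

variable [∀ j, (T j).IsLocallyFinite] (hl : ∀ j, (T j).IsLeafless)

include hl

theorem adjoint_multishiftOf_multiPow_eq_zero {j : Fin d} {f : L2 V}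
    (hf : f ∈ jointKernelOf T c hcs) (α : Fin d → ℕ) (hα : α j = 0) :
    ContinuousLinearMap.adjoint (multishiftOf T c hcs j)
      (multiPow (multishiftOf T c hcs) α f) = 0 := by
  induction α using MultiIndex.induction_add_single with
  | zero => simpa [multiPow_zero] using (Submodule.mem_iInf _).1 hf j
  | add_single β k ih =>
    have hkj : k ≠ j := by
      rintro rfl
      simp at hα
    rw [multiPow_add_single (commute_multishiftOf hc), mul_apply_eq_comp]
    exact adjoint_multishiftOf_multishiftOf_eq_zero hc hl hkj (ih (by simpa [hkj] using hα))

theorem adjoint_multishiftOf_multiPow_add_single {f : L2 V} {δ : Fin d → ℕ}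
    (hf : ∀ v, f v ≠ 0 → depth T v = δ) (α : Fin d → ℕ) (j : Fin d) :
    ContinuousLinearMap.adjoint (multishiftOf T c hcs j)
        (multiPow (multishiftOf T c hcs) (α + Pi.single j 1) f) =
      (growth c j (δ + α) : ℂ) • multiPow (multishiftOf T c hcs) α f := by
  ext v
  rw [multiPow_add_single (commute_multishiftOf hc), mul_apply_eq_comp,
    adjoint_multishiftOf_multishiftOf_apply hc hl, lp.coeFn_smul, Pi.smul_apply, smul_eq_mul]
  by_cases hv : multiPow (multishiftOf T c hcs) α f v = 0
  · rw [hv, mul_zero, mul_zero]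
  · rw [depth_of_multiPow_apply_ne_zero hc hf α v hv]

theorem inner_multiPow {x y : L2 V} {δ : Fin d → ℕ} (hx : x ∈ jointKernelOf T c hcs)
    (hy : y ∈ jointKernelOf T c hcs) (hyδ : ∀ v, y v ≠ 0 → depth T v = δ) (α β : Fin d → ℕ) :
    ⟪multiPow (multishiftOf T c hcs) α x, multiPow (multishiftOf T c hcs) β y⟫_ℂ =
      if α = β then ((kernelCoeff c δ α)⁻¹ : ℂ) * ⟪x, y⟫_ℂ else 0 := by
  have hpow := multiPow_add_single (commute_multishiftOf (T := T) (hcs := hcs) hc)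
  induction α using MultiIndex.induction_add_single generalizing β with
  | zero =>
    by_cases hβ : β = 0
    · simp [hβ, multiPow_zero, kernelCoeff_zero]
    · obtain ⟨j, hj⟩ := Function.ne_iff.1 hβ
      obtain ⟨γ, rfl⟩ := MultiIndex.exists_eq_add_single hj
      rw [if_neg (Ne.symm hβ), hpow, mul_apply_eq_comp, ← ContinuousLinearMap.adjoint_inner_left,
        adjoint_multishiftOf_multiPow_eq_zero hc hl hx 0 rfl, inner_zero_left]
  | add_single α j ih =>
    rw [hpow, mul_apply_eq_comp, ← ContinuousLinearMap.adjoint_inner_right]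
    by_cases hβ : β j = 0
    · have hne : α + Pi.single j 1 ≠ β := fun e => by simp [← e] at hβ
      rw [if_neg hne, adjoint_multishiftOf_multiPow_eq_zero hc hl hy β hβ, inner_zero_right]
    · obtain ⟨γ, rfl⟩ := MultiIndex.exists_eq_add_single hβ
      rw [adjoint_multishiftOf_multiPow_add_single hc hl hyδ, inner_smul_right, ih]
      simp only [add_left_inj]
      split_ifs with hαγ
      · rw [← hαγ, kernelCoeff_add_single hc, Complex.ofReal_mul, Complex.ofReal_inv, mul_inv,
          inv_inv, mul_assoc]
      · rw [mul_zero]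

end orthogonality

section siblings

variable {T} {F F' : Finset (Fin d)} {u u' v w : ∀ j, V j}

theorem mem_sibF_comm : w ∈ sibF T F v ↔ v ∈ sibF T F w :=
  and_congr (forall₂_congr fun _ _ => exists_congr fun _ => and_comm)
    (forall₂_congr fun _ _ => eq_comm)

theorem mem_Phi_of_mem_sibF (hu : u ∈ Phi T F) (hw : w ∈ sibF T F u) : w ∈ Phi T F := by
  intro j
  by_cases hj : j ∈ F
  · simp [hj, (RootedDirectedTree.mem_sib_iff.1 (hw.1 j hj)).2.1]
  · rw [hw.2 j hj]
    exact hu j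

theorem depth_of_mem_sibF (hw : w ∈ sibF T F u) : depth T w = depth T u := by
  funext j
  by_cases hj : j ∈ F
  · exact RootedDirectedTree.depth_of_mem_sib (hw.1 j hj)
  · simp [depth, hw.2 j hj]

theorem par_apply_eq_of_mem_sibF (hw : w ∈ sibF T F u) {j : Fin d} (hj : j ∈ F) :
    par T j w j = (T j).par (u j) := by
  rw [par_apply_self, (RootedDirectedTree.mem_sib_iff.1 (hw.1 j hj)).2.2]

theorem update_par_mem_sibF (hv : v ∈ sibF T F u) {j : Fin d} (hj : j ∈ F) {x : V j}
    (hx : (T j).Adj (par T j v j) x) : Function.update (par T j v) j x ∈ sibF T F u := by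
  refine ⟨fun i hi => ?_, fun i hi => ?_⟩
  · rcases eq_or_ne i j with rfl | hij
    · rw [Function.update_self]
      rw [par_apply_eq_of_mem_sibF hv hj] at hx
      exact ⟨_, (T i).adj_par (RootedDirectedTree.mem_sib_iff.1 (hv.1 i hi)).1, hx⟩
    · rw [Function.update_of_ne hij, par_apply_of_ne hij]
      exact hv.1 i hi
  · have hij : i ≠ j := fun e => hi (e ▸ hj)
    rw [Function.update_of_ne hij, par_apply_of_ne hij, hv.2 i hi]

theorem sib_update_restrict (hu : u ∈ Phi T F) (hv : v ∈ sibF T F u) {j : Fin d} (hj : j ∈ F) :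
    sib T j (Function.update (restrict T (F.erase j) v) j (u j)) = chi T j (par T j v) := by
  have hrestrict (i : Fin d) (hi : i ≠ j) : restrict T (F.erase j) v i = v i := by
    by_cases hiF : i ∈ F
    · simp [restrict, hi, hiF]
    · have hroot : v i = (T i).root := not_not.1 fun h => hiF ((mem_Phi_of_mem_sibF hu hv i).2 h)
      simp [restrict, hiF, hroot]
  ext w
  simp only [sib, chi, Set.mem_ofPred_eq, Function.update_self]
  refine and_congr ?_ (forall₂_congr fun i hi => ?_)
  · rw [RootedDirectedTree.mem_sib_iff, par_apply_eq_of_mem_sibF hv hj]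
    exact ⟨fun ⟨_, hw, hpar⟩ => hpar ▸ (T j).adj_par hw, fun hw =>
      ⟨(hu j).1 hj, (T j).ne_root_of_adj hw, (T j).par_eq hw⟩⟩
  · rw [Function.update_of_ne hi, hrestrict i hi, par_apply_of_ne hi]

variable {Ω : Finset (Fin d) → Set (∀ j, V j)} (hΩ : ∀ F, IsIndexingSet T F (Ω F))

include hΩ

theorem exists_mem_sibF (v : ∀ j, V j) : ∃ F, ∃ u ∈ Ω F, v ∈ sibF T F u := by
  classical
  obtain ⟨u, ⟨hu, huv⟩, -⟩ :=
    (hΩ (Finset.univ.filter fun j => v j ≠ (T j).root)).2 v fun j => by simp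
  exact ⟨_, u, hu, mem_sibF_comm.1 huv⟩

theorem eq_of_mem_sibF {p q : Σ F, Ω F} (hp : v ∈ sibF T p.1 p.2.1) (hq : v ∈ sibF T q.1 q.2.1) :
    p = q := by
  obtain ⟨F, u, hu⟩ := p
  obtain ⟨F', u', hu'⟩ := q
  have hv := mem_Phi_of_mem_sibF ((hΩ F).1 hu) hp
  obtain rfl : F = F' := by
    ext j
    exact (hv j).trans (mem_Phi_of_mem_sibF ((hΩ F').1 hu') hq j).symm
  obtain rfl := ((hΩ F).2 v hv).unique ⟨hu, mem_sibF_comm.1 hp⟩ ⟨hu', mem_sibF_comm.1 hq⟩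
  rfl

end siblings

section solSpace

variable {T} {c : ℕ → ℝ} {hcs : BddAbove (Set.range c)} {F : Finset (Fin d)} {u : ∀ j, V j}

open scoped InnerProductSpace

theorem inner_eq_zero_of_mem_solSpace {Ω : Finset (Fin d) → Set (∀ j, V j)}
    (hΩ : ∀ F, IsIndexingSet T F (Ω F)) {p q : Σ F, Ω F} (hpq : p ≠ q) {x y : L2 V}
    (hx : x ∈ solSpace T (weights T c) p.1 p.2.1) (hy : y ∈ solSpace T (weights T c) q.1 q.2.1) :
    ⟪x, y⟫_ℂ = 0 := by
  have hterm (v : ∀ j, V j) : ⟪x v, y v⟫_ℂ = 0 := by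
    by_cases hv : v ∈ sibF T p.1 p.2.1
    · rw [hy.1 v fun hv' => hpq (eq_of_mem_sibF hΩ hv hv'), inner_zero_right]
    · rw [hx.1 v hv, inner_zero_left]
  rw [lp.inner_eq_tsum, tsum_congr hterm, tsum_zero]

variable (T c) in
/-- The indices `(F, u)` of the nonzero spaces `𝓛_{u,F}`. -/
def nontrivialClasses (Ω : Finset (Fin d) → Set (∀ j, V j)) : Set (Σ F, Ω F) :=
  {p | solSpace T (weights T c) p.1 p.2.1 ≠ ⊥}

variable [∀ j, (T j).IsLocallyFinite]

theorem hasSum_weights_mul (hc : ∀ t, 0 < c t) (j : Fin d) (f : (∀ j, V j) → ℂ) (v : ∀ j, V j) :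
    HasSum (fun w : chi T j v => (weights T c j w : ℂ) * f w)
      (outWeight T c j v * childSum T j f v) := by
  have hchi : chi T j v =
      (((T j).chiFinset (v j)).map ⟨_, Function.update_injective v j⟩ : Finset (∀ j, V j)) := by
    rw [Finset.coe_map, chi_eq_image, RootedDirectedTree.chiFinset, Set.Finite.coe_toFinset]
    rfl
  have hsum : outWeight T c j v * childSum T j f v =
      ∑ w ∈ ((T j).chiFinset (v j)).map ⟨_, Function.update_injective v j⟩,
        (weights T c j w : ℂ) * f w := by
    rw [Finset.sum_map, childSum, Finset.mul_sum]
    refine Finset.sum_congr rfl fun x hx => ?_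
    rw [Function.Embedding.coeFn_mk, weights_eq_outWeight hc,
      par_update_self (RootedDirectedTree.mem_chiFinset.1 hx)]
  rw [hsum, hchi]
  exact Finset.hasSum _ fun w => (weights T c j w : ℂ) * f w

variable (hc : ∀ t, 0 < c t) (hl : ∀ j, (T j).IsLeafless)

include hc hl

/-- As the weights are constant on the sets of children, they can be dropped from the system
defining `𝓛_{u,F}`. -/
theorem mem_solSpace_iff (hu : u ∈ Phi T F) {f : L2 V} :
    f ∈ solSpace T (weights T c) F u ↔ (∀ v, v ∉ sibF T F u → f v = 0) ∧
      ∀ j ∈ F, ∀ v ∈ sibF T F u, childSum T j f (par T j v) = 0 := by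
  refine and_congr_right fun _ => forall₂_congr fun j hj => forall₂_congr fun v hv => ?_
  have hweight : (outWeight T c j (par T j v) : ℂ) ≠ 0 :=
    Complex.ofReal_ne_zero.2 (outWeight_pos hl hc j _).ne'
  have hsum := hasSum_weights_mul (T := T) hc j f (par T j v)
  rw [sib_update_restrict hu hv hj, ← mul_eq_zero_iff_left hweight]
  exact ⟨hsum.unique, fun h => h ▸ hsum⟩

theorem solSpace_le_jointKernelOf (hu : u ∈ Phi T F) :
    solSpace T (weights T c) F u ≤ jointKernelOf T c hcs := by
  intro f hf
  obtain ⟨hsupport, hsystem⟩ := (mem_solSpace_iff hc hl hu).1 hf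
  refine (mem_jointKernelOf_iff hc hl).2 fun j v => ?_
  by_cases hchild : ∃ x, (T j).Adj (v j) x ∧ Function.update v j x ∈ sibF T F u
  · obtain ⟨x, hx, hmem⟩ := hchild
    have hj : j ∈ F := (mem_Phi_of_mem_sibF hu hmem j).2 (by simpa using (T j).ne_root_of_adj hx)
    simpa only [par_update_self hx] using hsystem j hj _ hmem
  · push Not at hchild
    exact Finset.sum_eq_zero fun x hx =>
      hsupport _ (hchild x (RootedDirectedTree.mem_chiFinset.1 hx))

theorem exists_mem_solSpace_eqOn (hu : u ∈ Phi T F) (f : L2 V)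
    (hf : ∀ j ∈ F, ∀ v ∈ sibF T F u, childSum T j f (par T j v) = 0) :
    ∃ y ∈ solSpace T (weights T c) F u, Set.EqOn y f (sibF T F u) := by
  classical
  have happly (v : ∀ j, V j) :
      (∑ w ∈ (finite_sibF T F u).toFinset, lp.single 2 w (f w) : L2 V) v =
        if v ∈ sibF T F u then f v else 0 := by
    simp only [lp.coeFn_sum, Finset.sum_apply, lp.single_apply, Finset.sum_pi_single,
      Set.Finite.mem_toFinset]
  refine ⟨∑ w ∈ (finite_sibF T F u).toFinset, lp.single 2 w (f w),
    (mem_solSpace_iff hc hl hu).2 ⟨fun v hv => (happly v).trans (if_neg hv), fun j hj v hv => ?_⟩,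
    fun v hv => (happly v).trans (if_pos hv)⟩
  rw [← hf j hj v hv]
  exact Finset.sum_congr rfl fun x hx => (happly _).trans
    (if_pos (update_par_mem_sibF hv hj (RootedDirectedTree.mem_chiFinset.1 hx)))

theorem apply_eq_zero_of_forall_mem_solSpace (hu : u ∈ Phi T F) {f : L2 V}
    (hf : ∀ j ∈ F, ∀ v ∈ sibF T F u, childSum T j f (par T j v) = 0)
    (horth : ∀ y ∈ solSpace T (weights T c) F u, ⟪y, f⟫_ℂ = 0) {v : ∀ j, V j}
    (hv : v ∈ sibF T F u) : f v = 0 := by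
  obtain ⟨y, hy, hyf⟩ := exists_mem_solSpace_eqOn hc hl hu f hf
  have hterm (w : ∀ j, V j) : ⟪y w, y w⟫_ℂ = ⟪y w, f w⟫_ℂ := by
    by_cases hw : w ∈ sibF T F u
    · rw [hyf hw]
    · rw [hy.1 w hw, inner_zero_left, inner_zero_left]
  have hy0 : y = 0 := by
    rw [← inner_self_eq_zero (𝕜 := ℂ), lp.inner_eq_tsum, tsum_congr hterm, ← lp.inner_eq_tsum,
      horth y hy]
  rw [← hyf hv, hy0]
  rfl

variable {Ω : Finset (Fin d) → Set (∀ j, V j)} (hΩ : ∀ F, IsIndexingSet T F (Ω F))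

include hΩ

/-- A function orthogonal to all `S^α 𝓛_{u,F}` is annihilated by the adjoints at smaller depth by
induction, so it solves the systems defining the `𝓛_{u,F}`. -/
theorem eq_zero_of_forall_inner_multiPow_eq_zero (f : L2 V)
    (hf : ∀ p : Σ F, Ω F, ∀ y ∈ solSpace T (weights T c) p.1 p.2.1, ∀ α,
      ⟪multiPow (multishiftOf T c hcs) α y, f⟫_ℂ = 0) : f = 0 := by
  suffices h : ∀ (n : ℕ) (v : ∀ j, V j), ∑ i, depth T v i < n → f v = 0 from
    lp.ext (funext fun v => h _ v (Nat.lt_succ_self _))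
  intro n
  induction n generalizing f with
  | zero => exact fun v hv => absurd hv (Nat.not_lt_zero _)
  | succ n ih =>
    intro v hv
    obtain ⟨F, u, hu, hvu⟩ := exists_mem_sibF hΩ v
    refine apply_eq_zero_of_forall_mem_solSpace hc hl ((hΩ F).1 hu) (fun j hj w hw => ?_)
      (fun y hy => by simpa [multiPow_zero] using hf ⟨F, u, hu⟩ y hy 0) hvu
    have hroot := (mem_Phi_of_mem_sibF ((hΩ F).1 hu) hw j).1 hj
    have hadjoint : ContinuousLinearMap.adjoint (multishiftOf T c hcs j) f (par T j w) = 0 := by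
      refine ih _ (fun p y hy α => ?_) _ ?_
      · rw [ContinuousLinearMap.adjoint_inner_right, ← mul_apply_eq_comp,
          ← multiPow_add_single (commute_multishiftOf hc)]
        exact hf p y hy _
      · rw [depth_of_mem_sibF hvu, ← depth_of_mem_sibF hw, depth_eq_depth_par_add hroot,
          MultiIndex.sum_add_single] at hv
        exact Nat.lt_of_succ_lt_succ hv
    rw [adjoint_multishiftOf_apply hc] at hadjoint
    exact (mul_eq_zero.1 hadjoint).resolve_left
      (Complex.ofReal_ne_zero.2 (outWeight_pos hl hc j _).ne')

omit hΩ

theorem par_mem_branching_of_solSpace_ne_bot (hu : u ∈ Phi T F)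
    (h : solSpace T (weights T c) F u ≠ ⊥) {j : Fin d} (hj : j ∈ F) :
    (T j).par (u j) ∈ (T j).branching := by
  contrapose! h
  refine (Submodule.eq_bot_iff _).2 fun f hf => lp.ext (funext fun v => ?_)
  obtain ⟨hsupport, hsystem⟩ := (mem_solSpace_iff hc hl hu).1 hf
  by_cases hv : v ∈ sibF T F u
  · have hadj : (T j).Adj (par T j v j) (v j) := by
      rw [par_apply_self]
      exact (T j).adj_par ((mem_Phi_of_mem_sibF hu hv j).1 hj)
    have hencard : ((T j).chi (par T j v j)).encard ≤ 1 := by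
      rw [par_apply_eq_of_mem_sibF hv hj]
      exact Order.le_of_lt_add_one ((not_le.1 h).trans_eq one_add_one_eq_two.symm)
    have hsingleton : (T j).chiFinset (par T j v j) = {v j} :=
      Finset.eq_singleton_iff_unique_mem.2 ⟨RootedDirectedTree.mem_chiFinset.2 hadj, fun x hx =>
        Set.encard_le_one_iff.1 hencard _ _ (RootedDirectedTree.mem_chiFinset.1 hx) hadj⟩
    have hsum := hsystem j hj v hv
    rw [childSum, hsingleton, Finset.sum_singleton] at hsum
    simpa [par] using hsum
  · exact hsupport v hv

include hΩ

theorem finite_nontrivialClasses (hb : FiniteJointBranchingIndex T) :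
    (nontrivialClasses T c Ω).Finite := by
  choose b hb using fun j => (T j).exists_depth_le_of_branchingIndex_lt_top (hb j)
  have hfin : (Set.univ.pi fun j => {v | (T j).depth v ≤ b j + 1}).Finite :=
    Set.Finite.pi fun j => (T j).finite_setOf_depth_le _
  have hinj : Function.Injective fun p : Σ F, Ω F => (p.1, p.2.1) := by
    rintro ⟨F, u, hu⟩ ⟨F', u', hu'⟩ h
    obtain ⟨rfl, rfl⟩ := Prod.ext_iff.1 h
    rfl
  refine Set.Finite.of_finite_image ((Set.finite_univ.prod hfin).subset ?_) hinj.injOn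
  rintro _ ⟨⟨F, u, hu⟩, hp, rfl⟩
  refine ⟨trivial, fun j _ => ?_⟩
  have huΦ := (hΩ F).1 hu
  change (T j).depth (u j) ≤ b j + 1
  by_cases hj : j ∈ F
  · rw [(T j).depth_of_adj ((T j).adj_par ((huΦ j).1 hj))]
    exact Nat.succ_le_succ (hb j _ (par_mem_branching_of_solSpace_ne_bot hc hl huΦ hp hj))
  · have hroot : u j = (T j).root := not_not.1 fun h => hj ((huΦ j).2 h)
    rw [hroot, (T j).depth_root]
    exact Nat.zero_le _

end solSpace

section model

variable {T} {c : ℕ → ℝ} {hcs : BddAbove (Set.range c)} [∀ j, (T j).IsLocallyFinite]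
  {Ω : Finset (Fin d) → Set (∀ j, V j)}

theorem exists_abs_kernelCoeff_le {m : ℝ} (hm : 0 < m) (hmc : ∀ t, m ≤ c t) {ι : Type*} [Finite ι]
    (δ : ι → Fin d → ℕ) :
    ∃ C R : ℝ, 0 ≤ R ∧ ∀ i α, |kernelCoeff c (δ i) α| ≤ C * R ^ ∑ j, α j := by
  have := Fintype.ofFinite ι
  let C (i : ι) : ℝ := (∏ j, (δ i j).factorial : ℕ) * 2 ^ (∑ j, δ i j + d)
  have hC (i : ι) : 0 ≤ C i := by positivity
  refine ⟨∑ i, C i, 2 * d / m, by positivity, fun i α => ?_⟩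
  rw [abs_of_pos (kernelCoeff_pos (fun t => hm.trans_le (hmc t)) _ _)]
  refine (kernelCoeff_le hm hmc _ _).trans ?_
  gcongr
  exact Finset.single_le_sum (fun i _ => hC i) (Finset.mem_univ i)

theorem isWanderingSum_multishiftOf (hl : ∀ j, (T j).IsLeafless) {m : ℝ} (hm : 0 < m)
    (hmc : ∀ t, m ≤ c t) (hΩ : ∀ F, IsIndexingSet T F (Ω F))
    [Finite (nontrivialClasses T c Ω)] :
    AnalyticModel.IsWanderingSum (multishiftOf T c hcs) (jointKernelOf T c hcs).subtypeₗᵢ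
      (fun p : nontrivialClasses T c Ω =>
        solSpaceIn T (weights T c) (isBoundedWeights_weights T c hcs) p.1.1 p.1.2.1)
      (fun p => kernelCoeff c (depth T p.1.2.1)) := by
  have hc (t : ℕ) : 0 < c t := hm.trans_le (hmc t)
  exact {
    commute := commute_multishiftOf hc
    ne_zero := fun p α => (kernelCoeff_pos hc _ α).ne'
    bound := exists_abs_kernelCoeff_le hm hmc _
    orthogonal := fun p q hpq => Submodule.isOrtho_iff_inner_eq.2 fun x hx y hy =>
      inner_eq_zero_of_mem_solSpace hΩ (Subtype.coe_injective.ne hpq) hx hy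
    inner_pow := fun p y hy x α β => inner_multiPow hc hl x.2 y.2
      (fun v hv => depth_of_mem_sibF (not_imp_comm.1 (hy.1 v) hv)) α β
    total := by
      refine fun f hf => eq_zero_of_forall_inner_multiPow_eq_zero (hcs := hcs) hc hl hΩ f
        fun p y hy α => ?_
      by_cases hp : solSpace T (weights T c) p.1 p.2.1 = ⊥
      · rw [hp, Submodule.mem_bot] at hy
        rw [hy, map_zero, inner_zero_left]
      · exact hf ⟨p, hp⟩ ⟨y, solSpace_le_jointKernelOf hc hl ((hΩ p.1).1 p.2.2) hy⟩ hy α }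

theorem projOf_eq_zero {F : Finset (Fin d)} {u : ∀ j, V j}
    (h : solSpace T (weights T c) F u = ⊥) : projOf T c hcs F u = 0 := by
  have hbot : solSpaceIn T (weights T c) (isBoundedWeights_weights T c hcs) F u = ⊥ := by
    rw [solSpaceIn, h, Submodule.comap_bot, Submodule.ker_subtype]
  ext1 x
  refine (Submodule.mem_bot ℂ).1 (hbot ▸ ?_ : projOf T c hcs F u x ∈ _)
  exact Submodule.starProjection_apply_mem _ x

end model

end TreeProduct

theorem theorem2p6 {d : ℕ} (hd : 0 < d) {V : Fin d → Type u}
    (T : ∀ j, RootedDirectedTree (V j))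
    (hleafless : ∀ j, (T j).IsLeafless)
    [∀ j, (T j).IsLocallyFinite]
    (hbranch : TreeProduct.FiniteJointBranchingIndex T)
    (c : ℕ → ℝ) (hcpos : ∀ t, 0 < c t) (hcinf : 0 < ⨅ t, c t)
    (hcsup : BddAbove (Set.range c))
    (Ω : Finset (Fin d) → Set (∀ j, V j))
    (hΩ : ∀ F, TreeProduct.IsIndexingSet T F (Ω F)) :
    (∀ F, ∀ u ∈ Ω F,
      TreeProduct.solSpace T (TreeProduct.weights T c) F u ≤
        TreeProduct.jointKernelOf T c hcsup) ∧
    ∃ r : ℝ, 0 < r ∧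
    ∃ (H : Type u) (_ : NormedAddCommGroup H) (_ : InnerProductSpace ℂ H) (_ : CompleteSpace H)
      (_ : RKHS ℂ H (TreeProduct.Ball d r) (TreeProduct.jointKernelOf T c hcsup)),
      -- the elements of `H` are holomorphic `E`-valued functions on the ball
      (∀ f : H, ∃ g : EuclideanSpace ℂ (Fin d) → TreeProduct.jointKernelOf T c hcsup,
        DifferentiableOn ℂ g (TreeProduct.Ball d r) ∧
        ∀ z : TreeProduct.Ball d r, f z = g z) ∧
      -- the coordinate functions act on `H` as bounded multiplication operators, and `S_{λ_c}` is
      -- unitarily equivalent to the tuple of these operators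
      (∃ M : Fin d → H →L[ℂ] H,
        (∀ (j : Fin d) (f : H) (z : TreeProduct.Ball d r),
          M j f z = (z : EuclideanSpace ℂ (Fin d)) j • f z) ∧
        ∃ U : TreeProduct.L2 V ≃ₗᵢ[ℂ] H, ∀ (j : Fin d) (x : TreeProduct.L2 V),
          U (TreeProduct.multishiftOf T c hcsup j x) = M j (U x)) ∧
      -- the reproducing kernel
      ∀ z w : TreeProduct.Ball d r,
        (∀ F, ∀ u ∈ Ω F,
          Summable (TreeProduct.kernelTerm c (TreeProduct.depth T u) z w)) ∧
        HasSum (fun p : Σ F : Finset (Fin d), Ω F =>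
            (∑' α : Fin d → ℕ, TreeProduct.kernelTerm c (TreeProduct.depth T p.2.1) z w α) •
              TreeProduct.projOf T c hcsup p.1 p.2.1)
          (RKHS.kernel H z w) := by
  have hm (t : ℕ) : ⨅ t, c t ≤ c t := ciInf_le ⟨0, Set.forall_mem_range.2 fun t => (hcpos t).le⟩ t
  have hfin := TreeProduct.finite_nontrivialClasses hcpos hleafless hΩ hbranch
  have : Fintype (TreeProduct.nontrivialClasses T c Ω) := hfin.fintype
  have hsum := TreeProduct.isWanderingSum_multishiftOf (hcs := hcsup) hleafless hcinf hm hΩ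
  obtain ⟨r, ⟨inst, hhol, hmul, hker⟩, hsummable, hr⟩ := (hsum.eventually_exists_rkhs.and
    ((TreeProduct.eventually_summable_kernelTerm hcinf hm).and self_mem_nhdsWithin)).exists
  refine ⟨fun F u hu => TreeProduct.solSpace_le_jointKernelOf hcpos hleafless ((hΩ F).1 hu),
    r, hr, TreeProduct.L2 V, inferInstance, inferInstance, inferInstance, inst, hhol,
    ⟨TreeProduct.multishiftOf T c hcsup, hmul, LinearIsometryEquiv.refl ℂ _, fun j x => rfl⟩,
    fun z w => ⟨fun F u _ => hsummable _ z w, ?_⟩⟩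
  rw [hker z w]
  refine (hasSum_subtype_iff_of_support_subset
    (s := TreeProduct.nontrivialClasses T c Ω) fun p hp hbot => hp ?_).1 (hasSum_fintype _)
  exact (congrArg _ (TreeProduct.projOf_eq_zero hbot)).trans (smul_zero (M := ℂ)
    (A := TreeProduct.jointKernelOf T c hcsup →L[ℂ] TreeProduct.jointKernelOf T c hcsup) _)
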